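/- Let $k$ be a field. For a finite poset $\mathcal{P}$, let $\operatorname{mod}\mathcal{P}$ be the category of functors from $\mathcal{P}$ to finite-dimensional $k$-vector spaces, and let $\mathrm{K}_0^{\mathrm{sp}}(\mathcal{P})$ be its split Grothendieck group, i.e. the free abelian group on isomorphism classes $[M]$ modulo the relations $[M\oplus N]=[M]+[N]$. Let $\mathcal{X}$ be one of the two three-element posets $$\mathcal{X}'_3:\ 1<2,\ 1<3,\qquad\qquad \mathcal{X}''_3:\ 1<3,\ 2<3,$$ (with no other relations), let $\mathrm{I}$ be the set of isomorphism classes of indecomposable objects of $\operatorname{mod}\mathcal{X}$, and let $\mathcal{P}$ be a finite connected poset. Let $\mathrm{Emb}_{\mathcal{X}}^{\mathcal{P}}$ be the set of order embeddings $f:\mathcal{X}\to\mathcal{P}$ (maps with $x\le x'\Leftrightarrow f(x)\le f(x')$) up to automorphisms of $\mathcal{X}$, represented by chosen embeddings. For an order embedding $f$, let $f^*:\operatorname{mod}\mathcal{P}\to\operatorname{mod}\mathcal{X}$ be restriction along $f$ and $f_!$ its left adjoint. For $\mathrm{E}\subseteq\mathrm{Emb}_{\mathcal{X}}^{\mathcal{P}}$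 define homomorphisms $\mathbf{dimh}^{\mathrm{E}}_{\mathcal{X},\mathcal{P}},\ \mathbf{mult}^{\mathrm{E}}_{\mathcal{X},\mathcal{P}}:\mathrm{K}_0^{\mathrm{sp}}(\mathcal{P})\to\mathbb{Z}^{\mathrm{E}\times\mathrm{I}}$ by $$\mathbf{dimh}^{\mathrm{E}}_{\mathcal{X},\mathcal{P}}(M)_{(f,U)}=\dim_k\operatorname{Hom}_{\mathcal{X}}(U,f^*M),\qquad \mathbf{mult}^{\mathrm{E}}_{\mathcal{X},\mathcal{P}}(M)_{(f,U)}=\text{the multiplicity of } U \text{ in } f^*M$$ (the number of summands isomorphic to $U$ in a decomposition of $f^*M$ into indecomposables). Let $\mathrm{E}\subseteq\mathrm{Emb}_{\mathcal{X}}^{\mathcal{P}}$ satisfy $\bigcup_{f\in\mathrm{E}}\operatorname{Im}f=\mathcal{P}$, and let $\mathcal{H}_{\mathrm{E}}$ be the set of isomorphism classes of the modules $f_!U$ with $(f,U)\in\mathrm{E}\times\mathrm{I}$. Then $\mathcal{H}_{\mathrm{E}}$ is a basis of $\mathbf{dimh}^{\mathrm{E}}_{\mathcal{X},\mathcal{P}}$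 and also a basis of $\mathbf{mult}^{\mathrm{E}}_{\mathcal{X},\mathcal{P}}$. That is, for $\Psi$ either of these two homomorphisms: the image of $\Psi$ is finitely generated, the elements of $\mathcal{H}_{\mathrm{E}}$ are classes of indecomposable modules, the subgroup $\langle [H] : H\in\mathcal{H}_{\mathrm{E}}\rangle$ of $\mathrm{K}_0^{\mathrm{sp}}(\mathcal{P})$ is free on the elements $[H]$, and $\Psi$ restricts to an isomorphism of abelian groups $$\langle [H] : H\in\mathcal{H}_{\mathrm{E}}\rangle\longrightarrow\operatorname{Im}\Psi .$$ Moreover, if $\mathcal{X}=\mathcal{X}'_3$, then the Gabriel quiver of the endomorphism algebra $\operatorname{End}_{\mathcal{P}}\big(\bigoplus_{H\in\mathcal{H}_{\mathrm{E}}}H\big)$ has no oriented cycle, in the sense that whenever there are nonzero morphisms $X_1\to X_2\to\cdots\to X_n\to X_1$ with all $X_i$ in $\mathcal{H}_{\mathrm{E}}$, each of them is an isomorphism. -/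

import Mathlib

open CategoryTheory CategoryTheory.Limits

universe u v w

namespace PosetModules

section Generic

theorem finrank_hom_congr {C : Type u} [Category.{v} C] [Preadditive C]
    (k : Type w) [Field k] [Linear k C] (U : C) {A B : C} (φ : A ≅ B) :
    Module.finrank k (U ⟶ A) = Module.finrank k (U ⟶ B) :=
  (Linear.homCongr k (Iso.refl U) φ).finrank_eq

variable {C : Type u} [Category.{v} C] [Preadditive C] [HasBinaryBiproducts C]

section
variable [HasFiniteBiproducts C]

theorem nonempty_biproduct_succ_iso {n : ℕ} (Y : Fin (n + 1) → C) :
    Nonempty ((⨁ Y) ≅ Y 0 ⊞ ⨁ fun i : Fin n => Y i.succ) := by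
  have h := extendFanIsLimit Y (biproduct.isLimit fun i : Fin n => Y i.succ)
    (BinaryBiproduct.isLimit (Y 0) (⨁ fun i : Fin n => Y i.succ))
  exact ⟨(biproduct.isLimit Y).conePointUniqueUpToIso h⟩

/-- The multiplicity of `U` in `M`: the largest number of copies of `U` that can be split off
from `M` as a direct summand. -/
noncomputable def multiplicityIn (U M : C) : ℕ :=
  sSup {n : ℕ | ∃ N : C, Nonempty (M ≅ (⨁ fun _ : Fin n => U) ⊞ N)}

end

theorem exists_split_of_idempotent [IsIdempotentComplete C] {U : C}
    (e : U ⟶ U) (he : e ≫ e = e) :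
    ∃ (Y Z : C) (i : Y ⟶ U) (r : U ⟶ Y) (j : Z ⟶ U) (s : U ⟶ Z), Nonempty (U ≅ Y ⊞ Z) ∧
      i ≫ r = 𝟙 Y ∧ r ≫ i = e ∧ j ≫ s = 𝟙 Z ∧ s ≫ j = 𝟙 U - e := by
  obtain ⟨Y, i, r, hir, hri⟩ := IsIdempotentComplete.idempotents_split U e he
  obtain ⟨Z, j, s, hjs, hsj⟩ := IsIdempotentComplete.idempotents_split U (𝟙 U - e) (by
    simp [he])
  have his : i ≫ s = 0 := by
    have : i ≫ s = i ≫ (r ≫ i) ≫ (s ≫ j) ≫ s := by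
      simp only [Category.assoc, hjs, reassoc_of% hir, Category.comp_id]
    rw [this, hri, hsj, ← Category.assoc e]
    simp [he]
  have hjr : j ≫ r = 0 := by
    have : j ≫ r = j ≫ (s ≫ j) ≫ (r ≫ i) ≫ r := by
      simp only [Category.assoc, hir, reassoc_of% hjs, Category.comp_id]
    rw [this, hri, hsj, ← Category.assoc (_ - _)]
    simp [he]
  refine ⟨Y, Z, i, r, j, s, ?_, hir, hri, hjs, hsj⟩
  let b : BinaryBicone Y Z :=
    { pt := U, fst := r, snd := s, inl := i, inr := j, inl_fst := hir, inl_snd := his,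
      inr_fst := hjr, inr_snd := hjs }
  exact ⟨biprod.uniqueUpToIso Y Z (isBinaryBilimitOfTotal b (by simp [b, hri, hsj]))⟩

/-- Fitting's lemma. -/
theorem isUnit_or_isUnit_of_indecomposable (k : Type w) [Field k] [Linear k C] [IsIdempotentComplete C] {U : C}
    [FiniteDimensional k (U ⟶ U)] (hU : Indecomposable U) (a : End U) :
    IsUnit a ∨ IsUnit (1 - a) := by
  have : FiniteDimensional k (End U) := inferInstanceAs (FiniteDimensional k (U ⟶ U))
  let S := Algebra.adjoin k {a}
  let x : S := ⟨a, Algebra.subset_adjoin rfl⟩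
  have : IsMulCommutative S :=
    Algebra.isMulCommutative_adjoin k (by rintro _ rfl _ rfl; rfl)
  have : IsArtinianRing S := IsArtinianRing.of_finite k S
  obtain ⟨n, y, hy⟩ := IsArtinian.exists_pow_succ_smul_dvd x (1 : S)
  simp only [smul_eq_mul, mul_one, Nat.succ_eq_add_one] at hy
  have key : ∀ m, x ^ n = x ^ n * (x ^ m * y ^ m) := by
    intro m
    induction m with
    | zero => simp
    | succ m ih =>
      calc x ^ n = x ^ n * (x ^ m * y ^ m) := ih
        _ = (x ^ (n + 1) * y) * (x ^ m * y ^ m) := by rw [hy]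
        _ = _ := by ring
  set e : S := x ^ n * y ^ n with he
  have hee : e * e = e := by
    have := key n
    calc e * e = (x ^ n * (x ^ n * y ^ n)) * y ^ n := by rw [he]; ring
      _ = e := by rw [← this]
  have he' : ((e : End U) : U ⟶ U) ≫ (e : End U) = (e : End U) := by
    have := congrArg (Subtype.val : S → End U) hee
    exact this
  obtain ⟨Y, Z, i, r, j, s, ⟨φ⟩, hir, hri, hjs, hsj⟩ := exists_split_of_idempotent _ he'
  rcases hU.2 Y Z φ with hY | hZ
  · right
    have h0 : e = 0 := Subtype.ext (by
      change (e : End U) = (0 : U ⟶ U)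
      rw [← hri, hY.eq_of_tgt r 0, zero_comp])
    have hx : x ^ n = 0 := by rw [key n, ← he, h0, mul_zero]
    have ha : a ^ n = 0 := by
      have := congrArg (Subtype.val : S → End U) hx
      simpa using this
    exact IsNilpotent.isUnit_one_sub ⟨n, ha⟩
  · left
    have h1 : e = 1 := Subtype.ext (by
      change (e : End U) = 𝟙 U
      have : 𝟙 U - (show U ⟶ U from (e : End U)) = 0 := by rw [← hsj, hZ.eq_of_tgt s 0, zero_comp]
      exact (sub_eq_zero.1 this).symm)
    have hx : x * (x ^ n * y ^ (n + 1)) = 1 := by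
      calc x * (x ^ n * y ^ (n + 1)) = (x ^ (n + 1) * y) * y ^ n := by ring
        _ = 1 := by rw [hy, ← he, h1]
    have hux : IsUnit x := IsUnit.of_mul_eq_one _ hx
    exact hux.map S.val

theorem cancel_indecomposable (k : Type w) [Field k] [Linear k C] [IsIdempotentComplete C] {U : C}
    [FiniteDimensional k (U ⟶ U)] (hU : Indecomposable U) {A B : C} (φ : U ⊞ A ≅ U ⊞ B) :
    Nonempty (A ≅ B) := by
  by_cases h : IsIso (biprod.inl ≫ φ.hom ≫ biprod.fst)
  · exact ⟨Biprod.isoElim φ⟩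
  let a : U ⟶ U := biprod.inl ≫ φ.hom ≫ biprod.fst
  let a' : U ⟶ U := biprod.inl ≫ φ.inv ≫ biprod.fst
  let t : U ⟶ A := biprod.inl ≫ φ.inv ≫ biprod.snd
  let b : A ⟶ U := biprod.inr ≫ φ.hom ≫ biprod.fst
  have h1 : a' ≫ a + t ≫ b = 𝟙 U := by
    have : biprod.inl ≫ φ.inv ≫ (biprod.fst ≫ biprod.inl + biprod.snd ≫ biprod.inr) ≫
      φ.hom ≫ biprod.fst = 𝟙 U := by simp
    rw [← this]
    simp only [a, a', t, b, Preadditive.comp_add, Preadditive.add_comp, Category.assoc]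
  let ψ : U ⊞ A ≅ U ⊞ A :=
    { hom := biprod.desc (biprod.lift (𝟙 U) t) biprod.inr
      inv := biprod.desc (biprod.lift (𝟙 U) (-t)) biprod.inr
      hom_inv_id := by
        ext <;> simp
      inv_hom_id := by
        ext <;> simp }
  have hψ : biprod.inl ≫ (ψ ≪≫ φ).hom ≫ biprod.fst = a + t ≫ b := by
    have : biprod.lift (𝟙 U) t = 𝟙 U ≫ biprod.inl + t ≫ biprod.inr := biprod.lift_eq
    simp [ψ, this, a, b, Preadditive.add_comp]
  have hiso : IsIso (a + t ≫ b) := by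
    have e1 : a + t ≫ b = 𝟙 U - (a' ≫ a - a) := by rw [← h1]; abel
    rcases isUnit_or_isUnit_of_indecomposable k hU (a' ≫ a - a : U ⟶ U) with hu | hu
    · exfalso
      have : FiniteDimensional k (End U) := inferInstanceAs (FiniteDimensional k (U ⟶ U))
      have : IsArtinianRing (End U) := IsArtinianRing.of_finite k (End U)
      let x : End U := a
      let y : End U := a' - 𝟙 U
      have h2 : x * y = (a' ≫ a - a : U ⟶ U) := by
        change (a' - 𝟙 U) ≫ a = _
        simp
      have h3 : IsUnit (x * y) := h2 ▸ hu
      rw [IsUnit.mul_iff] at h3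
      exact h ((isUnit_iff_isIso _).1 h3.1)
    · rw [e1]; exact (isUnit_iff_isIso _).1 hu
  rw [← hψ] at hiso
  exact ⟨Biprod.isoElim (ψ ≪≫ φ)⟩


theorem exists_summand_of_indecomposable (k : Type w) [Field k] [Linear k C] [IsIdempotentComplete C] {U : C}
    [FiniteDimensional k (U ⟶ U)] (hU : Indecomposable U) {A B N : C} (φ : A ⊞ B ≅ U ⊞ N) :
    (∃ A', Nonempty (A ≅ U ⊞ A')) ∨ ∃ B', Nonempty (B ≅ U ⊞ B') := by
  have key : ∀ (D : C) (p : U ⟶ D) (q : D ⟶ U), IsIso (p ≫ q) →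
      ∃ D', Nonempty (D ≅ U ⊞ D') := by
    intro D p q h
    let r : D ⟶ U := q ≫ inv (p ≫ q)
    have hpr : p ≫ r = 𝟙 U := by simp [r, ← Category.assoc]
    obtain ⟨Y, Z, i, s, _, _, ⟨ψ⟩, his, hsi, -⟩ :=
      exists_split_of_idempotent (r ≫ p) (by simp [reassoc_of% hpr])
    let χ : Y ≅ U :=
      { hom := i ≫ r
        inv := p ≫ s
        hom_inv_id := by
          have : i ≫ (r ≫ p) ≫ s = 𝟙 Y := by rw [← hsi]; simp [his]
          simpa using this
        inv_hom_id := by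
          have : p ≫ (s ≫ i) ≫ r = 𝟙 U := by rw [hsi]; simp [hpr]
          simpa using this }
    exact ⟨Z, ⟨ψ ≪≫ biprod.mapIso χ (Iso.refl Z)⟩⟩
  let p : U ⟶ A := biprod.inl ≫ φ.inv ≫ biprod.fst
  let p' : A ⟶ U := biprod.inl ≫ φ.hom ≫ biprod.fst
  let q : U ⟶ B := biprod.inl ≫ φ.inv ≫ biprod.snd
  let q' : B ⟶ U := biprod.inr ≫ φ.hom ≫ biprod.fst
  have h1 : p ≫ p' + q ≫ q' = 𝟙 U := by
    have : biprod.inl ≫ φ.inv ≫ (biprod.fst ≫ biprod.inl + biprod.snd ≫ biprod.inr) ≫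
      φ.hom ≫ biprod.fst = 𝟙 U := by simp
    rw [← this]
    simp only [p, p', q, q', Preadditive.comp_add, Preadditive.add_comp, Category.assoc]
  rcases isUnit_or_isUnit_of_indecomposable k hU (p ≫ p' : U ⟶ U) with hu | hu
  · exact Or.inl (key A p p' ((isUnit_iff_isIso _).1 hu))
  · have h2 : 𝟙 U - p ≫ p' = q ≫ q' := by rw [← h1]; abel
    refine Or.inr (key B q q' ?_)
    rw [← h2]
    exact (isUnit_iff_isIso _).1 hu

theorem finrank_hom_biprod (k : Type w) [Field k] [Linear k C] (U A B : C) [FiniteDimensional k (U ⟶ A)]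
    [FiniteDimensional k (U ⟶ B)] :
    Module.finrank k (U ⟶ A ⊞ B) = Module.finrank k (U ⟶ A) + Module.finrank k (U ⟶ B) := by
  let e : (U ⟶ A ⊞ B) ≃ₗ[k] (U ⟶ A) × (U ⟶ B) :=
    { toFun f := (f ≫ biprod.fst, f ≫ biprod.snd)
      invFun g := biprod.lift g.1 g.2
      map_add' f g := by simp
      map_smul' c f := by simp
      left_inv f := by ext <;> simp
      right_inv g := by simp }
  rw [e.finrank_eq, Module.finrank_prod]

variable [HasFiniteBiproducts C]

theorem summandPow_succ {U M : C} {n : ℕ} :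
    (∃ N : C, Nonempty (M ≅ (⨁ fun _ : Fin (n + 1) => U) ⊞ N)) ↔
      ∃ M' : C, Nonempty (M ≅ U ⊞ M') ∧ ∃ N : C, Nonempty (M' ≅ (⨁ fun _ : Fin n => U) ⊞ N) := by
  obtain ⟨σ⟩ := nonempty_biproduct_succ_iso (fun _ : Fin (n + 1) => U)
  constructor
  · rintro ⟨N, ⟨φ⟩⟩
    exact ⟨_, ⟨φ ≪≫ biprod.mapIso σ (Iso.refl N) ≪≫ biprod.associator _ _ _⟩, N, ⟨Iso.refl _⟩⟩
  · rintro ⟨M', ⟨φ⟩, N, ⟨ψ⟩⟩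
    exact ⟨N, ⟨φ ≪≫ biprod.mapIso (Iso.refl U) ψ ≪≫ (biprod.associator _ _ _).symm ≪≫
      biprod.mapIso σ.symm (Iso.refl N)⟩⟩

theorem nonempty_iso_biproduct_zero (U M : C) :
    Nonempty (M ≅ (⨁ fun _ : Fin 0 => U) ⊞ M) := by
  have hz : IsZero (⨁ fun _ : Fin 0 => U) := by
    rw [IsZero.iff_id_eq_zero]
    ext i
    exact i.elim0
  exact ⟨{ hom := biprod.inr
           inv := biprod.snd
           hom_inv_id := by simp
           inv_hom_id := by
            ext
            all_goals first | exact Fin.elim0 ‹Fin 0› | simp }⟩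

theorem le_finrank_of_summandPow (k : Type w) [Field k] [Linear k C]
    [∀ A B : C, FiniteDimensional k (A ⟶ B)] {U : C} (hU : Indecomposable U) :
    ∀ (n : ℕ) (M : C), (∃ N : C, Nonempty (M ≅ (⨁ fun _ : Fin n => U) ⊞ N)) →
      n ≤ Module.finrank k (U ⟶ M)
  | 0, _, _ => Nat.zero_le _
  | n + 1, M, h => by
    obtain ⟨M', ⟨φ⟩, h'⟩ := summandPow_succ.1 h
    have := le_finrank_of_summandPow k hU n M' h'
    rw [finrank_hom_congr k U φ, finrank_hom_biprod]
    have : 0 < Module.finrank k (U ⟶ U) := by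
      rw [Module.finrank_pos_iff_exists_ne_zero]
      exact ⟨𝟙 U, fun h0 => hU.1 ((IsZero.iff_id_eq_zero U).2 h0)⟩
    omega

theorem bddAbove_summandPow (k : Type w) [Field k] [Linear k C]
    [∀ A B : C, FiniteDimensional k (A ⟶ B)] {U : C} (hU : Indecomposable U) (M : C) :
    BddAbove {n : ℕ | ∃ N : C, Nonempty (M ≅ (⨁ fun _ : Fin n => U) ⊞ N)} :=
  ⟨_, fun n hn => le_finrank_of_summandPow k hU n M hn⟩

theorem summandPow_add {U B : C} : ∀ (n m : ℕ) (A : C),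
    (∃ N : C, Nonempty (A ≅ (⨁ fun _ : Fin n => U) ⊞ N)) →
    (∃ N : C, Nonempty (B ≅ (⨁ fun _ : Fin m => U) ⊞ N)) →
    ∃ N : C, Nonempty ((A ⊞ B) ≅ (⨁ fun _ : Fin (n + m) => U) ⊞ N)
  | 0, m, A, _, ⟨N, ⟨ψ⟩⟩ => by
    rw [Nat.zero_add]
    exact ⟨N ⊞ A, ⟨biprod.braiding _ _ ≪≫ biprod.mapIso ψ (Iso.refl A) ≪≫
      biprod.associator _ _ _⟩⟩
  | n + 1, m, A, hA, hB => by
    obtain ⟨A', ⟨φ⟩, hA'⟩ := summandPow_succ.1 hA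
    have := summandPow_add n m A' hA' hB
    rw [show n + 1 + m = (n + m) + 1 by omega]
    exact summandPow_succ.2 ⟨A' ⊞ B, ⟨biprod.mapIso φ (Iso.refl B) ≪≫ biprod.associator _ _ _⟩,
      this⟩

theorem exists_of_summandPow_biprod (k : Type w) [Field k] [Linear k C]
    [∀ A B : C, FiniteDimensional k (A ⟶ B)] [IsIdempotentComplete C] {U : C} (hU : Indecomposable U) :
    ∀ (n : ℕ) (A B : C), (∃ N : C, Nonempty ((A ⊞ B) ≅ (⨁ fun _ : Fin n => U) ⊞ N)) →
      ∃ p q : ℕ, n = p + q ∧ (∃ N : C, Nonempty (A ≅ (⨁ fun _ : Fin p => U) ⊞ N)) ∧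
        ∃ N : C, Nonempty (B ≅ (⨁ fun _ : Fin q => U) ⊞ N)
  | 0, A, B, _ => ⟨0, 0, rfl, ⟨A, nonempty_iso_biproduct_zero U A⟩,
      ⟨B, nonempty_iso_biproduct_zero U B⟩⟩
  | n + 1, A, B, h => by
    obtain ⟨M', ⟨φ⟩, N, ⟨ψ⟩⟩ := summandPow_succ.1 h
    rcases exists_summand_of_indecomposable k hU φ with ⟨A', ⟨α⟩⟩ | ⟨B', ⟨β⟩⟩
    · obtain ⟨γ⟩ := cancel_indecomposable k hU ((biprod.associator U A' B).symm ≪≫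
        biprod.mapIso α.symm (Iso.refl B) ≪≫ φ)
      obtain ⟨p, q, rfl, hp, hq⟩ := exists_of_summandPow_biprod k hU n A' B ⟨N, ⟨γ ≪≫ ψ⟩⟩
      exact ⟨p + 1, q, by omega, summandPow_succ.2 ⟨A', ⟨α⟩, hp⟩, hq⟩
    · obtain ⟨γ⟩ := cancel_indecomposable k hU ((biprod.associator U B' A).symm ≪≫
        biprod.mapIso β.symm (Iso.refl A) ≪≫ biprod.braiding _ _ ≪≫ φ)
      obtain ⟨p, q, rfl, hp, hq⟩ := exists_of_summandPow_biprod k hU n A B'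
        ⟨N, ⟨biprod.braiding _ _ ≪≫ γ ≪≫ ψ⟩⟩
      exact ⟨p, q + 1, by omega, hp, summandPow_succ.2 ⟨B', ⟨β⟩, hq⟩⟩

theorem exists_iso_multiplicityIn (k : Type w) [Field k] [Linear k C]
    [∀ A B : C, FiniteDimensional k (A ⟶ B)] {U : C} (hU : Indecomposable U) (M : C) :
    ∃ N : C, Nonempty (M ≅ (⨁ fun _ : Fin (multiplicityIn U M) => U) ⊞ N) :=
  Nat.sSup_mem (s := {n : ℕ | ∃ N : C, Nonempty (M ≅ (⨁ fun _ : Fin n => U) ⊞ N)})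
    ⟨0, M, nonempty_iso_biproduct_zero U M⟩ (bddAbove_summandPow k hU M)

theorem multiplicityIn_congr {U A B : C} (φ : A ≅ B) :
    multiplicityIn U A = multiplicityIn U B := by
  unfold multiplicityIn
  congr 1
  ext n
  exact ⟨fun ⟨N, ⟨ψ⟩⟩ => ⟨N, ⟨φ.symm ≪≫ ψ⟩⟩, fun ⟨N, ⟨ψ⟩⟩ => ⟨N, ⟨φ ≪≫ ψ⟩⟩⟩

theorem multiplicityIn_biprod (k : Type w) [Field k] [Linear k C]
    [∀ A B : C, FiniteDimensional k (A ⟶ B)] [IsIdempotentComplete C] {U : C} (hU : Indecomposable U) (A B : C) :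
    multiplicityIn U (A ⊞ B) = multiplicityIn U A + multiplicityIn U B := by
  have hA := exists_iso_multiplicityIn k hU A
  have hB := exists_iso_multiplicityIn k hU B
  have hM := exists_iso_multiplicityIn k hU (A ⊞ B)
  apply le_antisymm
  · obtain ⟨p, q, h, hp, hq⟩ := exists_of_summandPow_biprod k hU _ A B hM
    calc multiplicityIn U (A ⊞ B) = p + q := h
      _ ≤ _ := add_le_add (le_csSup (bddAbove_summandPow k hU A) hp)
        (le_csSup (bddAbove_summandPow k hU B) hq)
  · exact le_csSup (bddAbove_summandPow k hU (A ⊞ B)) (summandPow_add _ _ A hA hB)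

theorem multiplicityIn_of_indecomposable (k : Type w) [Field k] [Linear k C]
    [∀ A B : C, FiniteDimensional k (A ⟶ B)] {U V : C} (hU : Indecomposable U)
    (hV : Indecomposable V) [Decidable (Nonempty (V ≅ U))] :
    multiplicityIn U V = if Nonempty (V ≅ U) then 1 else 0 := by
  have hz : IsZero (⨁ fun _ : Fin 0 => U) := by
    rw [IsZero.iff_id_eq_zero]
    ext i
    exact i.elim0
  have h0 : ∀ M' : C, Nonempty (V ≅ U ⊞ M') → IsZero M' := by
    rintro M' ⟨φ⟩
    exact (hV.2 _ _ φ).resolve_left hU.1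
  have hmem := exists_iso_multiplicityIn k hU V
  have hle : multiplicityIn U V ≤ 1 := by
    rcases h : multiplicityIn U V with _ | _ | n
    · simp
    · simp
    · rw [h] at hmem
      obtain ⟨M', hM', hmem'⟩ := summandPow_succ.1 hmem
      obtain ⟨M'', ⟨ψ⟩, -⟩ := summandPow_succ.1 hmem'
      have hz' := (h0 M' hM').of_iso ψ.symm
      exact absurd (hz'.of_mono (biprod.inl : U ⟶ U ⊞ M'')) hU.1
  split_ifs with hiso
  · obtain ⟨φ⟩ := hiso
    refine le_antisymm hle (le_csSup (bddAbove_summandPow k hU V) ?_)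
    refine summandPow_succ.2 ⟨⨁ fun _ : Fin 0 => U, ?_, _, nonempty_iso_biproduct_zero U _⟩
    obtain ⟨χ⟩ := nonempty_iso_biproduct_zero U V
    exact ⟨χ ≪≫ biprod.braiding _ _ ≪≫ biprod.mapIso φ (Iso.refl _)⟩
  · by_contra hne
    have h1 : multiplicityIn U V = 0 + 1 := by omega
    rw [h1] at hmem
    obtain ⟨M', ⟨φ⟩, -⟩ := summandPow_succ.1 hmem
    have hz' := h0 M' ⟨φ⟩
    have e : U ⊞ M' ≅ U :=
      { hom := biprod.fst
        inv := biprod.inl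
        hom_inv_id := by
          ext
          · simp
          · simp
          · exact hz'.eq_of_src _ _
          · exact hz'.eq_of_src _ _ }
    exact hiso ⟨φ ≪≫ e⟩

open Classical in
/-- In a decomposition of `M` into indecomposable objects, the multiplicity of `U` in `M` is the
number of summands isomorphic to `U`. -/
theorem multiplicityIn_eq_card (k : Type w) [Field k] [Linear k C]
    [∀ A B : C, FiniteDimensional k (A ⟶ B)] [IsIdempotentComplete C] {U : C}
    (hU : Indecomposable U) :
    ∀ {n : ℕ} {M : C} (Y : Fin n → C), (∀ i, Indecomposable (Y i)) → (M ≅ ⨁ Y) →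
      multiplicityIn U M = Finset.card {i | Nonempty (Y i ≅ U)}
  | 0, M, Y, _, φ => by
    have hz : IsZero M := by
      refine IsZero.of_iso ?_ φ
      rw [IsZero.iff_id_eq_zero]
      ext i
      exact i.elim0
    have hmem := exists_iso_multiplicityIn k hU M
    have hle := le_finrank_of_summandPow k hU _ M hmem
    have : Subsingleton (U ⟶ M) := ⟨fun f g => hz.eq_of_tgt f g⟩
    rw [Module.finrank_zero_of_subsingleton] at hle
    have h0 : multiplicityIn U M = 0 := Nat.le_zero.1 hle
    rw [h0]
    simp
  | n + 1, M, Y, hY, φ => by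
    obtain ⟨σ⟩ := nonempty_biproduct_succ_iso Y
    rw [multiplicityIn_congr (φ ≪≫ σ), multiplicityIn_biprod k hU,
      multiplicityIn_of_indecomposable k hU (hY 0),
      multiplicityIn_eq_card k hU (fun i : Fin n => Y i.succ) (fun i => hY _) (Iso.refl _),
      Fin.card_filter_univ_succ]
    split_ifs <;> simp [add_comm]

end Generic

section SplitGrothendieckGroup

variable (C : Type u) [Category.{v} C]

/-- Isomorphism classes of objects of `C`. -/
def IsoClass : Type u := Quotient (isIsomorphicSetoid C)

variable {C}

/-- The isomorphism class of an object. -/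
def IsoClass.mk (M : C) : IsoClass C := Quotient.mk (isIsomorphicSetoid C) M

/-- A representative of an isomorphism class. -/
noncomputable def IsoClass.rep (c : IsoClass C) : C := Quotient.out c

theorem IsoClass.mk_eq_mk_iff {M N : C} : IsoClass.mk M = IsoClass.mk N ↔ Nonempty (M ≅ N) :=
  Quotient.eq (r := isIsomorphicSetoid C)

theorem IsoClass.mk_rep (c : IsoClass C) : IsoClass.mk c.rep = c := Quotient.out_eq c

/-- The function on isomorphism classes given by a function on objects that is constant on
isomorphism classes. -/
def IsoClass.lift {A : Type*} (φ : C → A) (hiso : ∀ M N : C, Nonempty (M ≅ N) → φ M = φ N)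
    (c : IsoClass C) : A :=
  Quotient.lift (s := isIsomorphicSetoid C) φ hiso c

theorem IsoClass.lift_mk {A : Type*} (φ : C → A)
    (hiso : ∀ M N : C, Nonempty (M ≅ N) → φ M = φ N) (M : C) :
    IsoClass.lift φ hiso (IsoClass.mk M) = φ M := rfl

variable [Preadditive C] [HasBinaryBiproducts C]

variable (C) in
/-- The isomorphism classes of indecomposable objects of `C`. -/
def IndClass : Type u := {c : IsoClass C // Indecomposable c.rep}

variable (C) in
/-- The relations `[M ⊞ N] = [M] + [N]`. -/
def splitRelations : AddSubgroup (FreeAbelianGroup (IsoClass C)) :=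
  AddSubgroup.closure {z | ∃ M N : C, z = FreeAbelianGroup.of (IsoClass.mk (M ⊞ N)) -
    (FreeAbelianGroup.of (IsoClass.mk M) + FreeAbelianGroup.of (IsoClass.mk N))}

variable (C) in
/-- The split Grothendieck group of `C`. -/
abbrev SplitK0 : Type u := FreeAbelianGroup (IsoClass C) ⧸ splitRelations C

/-- The class in the split Grothendieck group of an isomorphism class of objects. -/
def SplitK0.cls (c : IsoClass C) : SplitK0 C :=
  QuotientAddGroup.mk' (splitRelations C) (FreeAbelianGroup.of c)

/-- The homomorphism on the split Grothendieck group given by a function on objects that is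
constant on isomorphism classes and additive on direct sums. -/
def SplitK0.lift {A : Type*} [AddCommGroup A] (φ : C → A)
    (hiso : ∀ M N : C, Nonempty (M ≅ N) → φ M = φ N)
    (hadd : ∀ M N : C, φ (M ⊞ N) = φ M + φ N) : SplitK0 C →+ A :=
  QuotientAddGroup.lift (splitRelations C)
    (FreeAbelianGroup.lift (IsoClass.lift φ hiso)) (by
      rw [splitRelations, AddSubgroup.closure_le]
      rintro z ⟨M, N, rfl⟩
      simp [IsoClass.lift_mk, hadd])

theorem SplitK0.lift_cls {A : Type*} [AddCommGroup A] (φ : C → A)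
    (hiso : ∀ M N : C, Nonempty (M ≅ N) → φ M = φ N)
    (hadd : ∀ M N : C, φ (M ⊞ N) = φ M + φ N) (M : C) :
    SplitK0.lift φ hiso hadd (SplitK0.cls (IsoClass.mk M)) = φ M := by
  simp [SplitK0.lift, SplitK0.cls, IsoClass.lift_mk]

/-- A set `B` of isomorphism classes is a basis of the finite invariant `Ψ` if it consists of
classes of indecomposable objects, the subgroup generated by `[U]`, `U ∈ B`, is free on these
elements, and `Ψ` restricts to an isomorphism from this subgroup onto the image of `Ψ`. -/
structure IsInvariantBasis {J : Type*} (Ψ : SplitK0 C →+ (J → ℤ)) (B : Set (IsoClass C)) :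
    Prop where
  range_fg : Ψ.range.FG
  indecomposable : ∀ c ∈ B, Indecomposable c.rep
  linearIndependent : LinearIndependent ℤ (fun c : B => SplitK0.cls c.1)
  bijective : Function.Bijective
    (Ψ.rangeRestrict.comp (AddSubgroup.closure (SplitK0.cls '' B)).subtype)

/-- For a set `B` of isomorphism classes of indecomposable objects: in every closed chain of
nonzero morphisms between objects whose classes are in `B`, all morphisms are isomorphisms. For a
finite set of indecomposable modules this says that the Gabriel quiver of the endomorphism algebra
of their direct sum has no oriented cycle. -/
def HasAcyclicGabrielQuiver (B : Set (IsoClass C)) : Prop :=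
  ∀ (n : ℕ) (Y : Fin (n + 1) → C) (g : ∀ i, Y i ⟶ Y (i + 1)),
    (∀ i, IsoClass.mk (Y i) ∈ B) → (∀ i, g i ≠ 0) → ∀ i, IsIso (g i)

end SplitGrothendieckGroup

section PosetModules

/-- The category of `P`-modules: functors from the poset `P` to finite-dimensional vector
spaces. -/
abbrev PMod (k : Type u) [Field k] (P : Type w) [PartialOrder P] : Type (max w (u + 1)) :=
  P ⥤ FGModuleCat.{u} k

variable (k : Type u) [Field k] {X : Type v} [PartialOrder X] {P : Type w} [PartialOrder P]

instance : HasFiniteBiproducts (PMod k P) := Abelian.hasFiniteBiproducts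

instance [Finite P] (M N : PMod k P) : FiniteDimensional k (M ⟶ N) := by
  let φ : (M ⟶ N) →ₗ[k] (∀ p : P, M.obj p ⟶ N.obj p) :=
    { toFun α := fun p => α.app p
      map_add' _ _ := rfl
      map_smul' _ _ := rfl }
  exact Module.Finite.of_injective φ fun α β h => NatTrans.ext h

/-- Restriction of modules along an order embedding. -/
abbrev restrict (f : X ↪o P) : PMod k P ⥤ PMod k X :=
  (Functor.whiskeringLeft X P (FGModuleCat.{u} k)).obj f.monotone.functor

theorem nonempty_restrict_biprod_iso (f : X ↪o P) (M N : PMod k P) :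
    Nonempty ((restrict k f).obj (M ⊞ N) ≅ (restrict k f).obj M ⊞ (restrict k f).obj N) := by
  have : PreservesBinaryBiproducts (restrict k f) :=
    preservesBinaryBiproducts_of_preservesBiproducts _
  exact ⟨(restrict k f).mapBiprod M N⟩

instance (f : X ↪o P) [Finite X] (p : P) :
    HasColimitsOfShape (CostructuredArrow f.monotone.functor p) (FGModuleCat.{u} k) := by
  let J := {x : X // f x ≤ p}
  let e : J ≌ CostructuredArrow f.monotone.functor p :=
    { functor :=
        { obj j := CostructuredArrow.mk (Y := j.1) (homOfLE j.2)
          map {i j} h := CostructuredArrow.homMk (homOfLE (leOfHom h)) }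
      inverse :=
        { obj a := ⟨a.left, leOfHom a.hom⟩
          map {a b} h := homOfLE (leOfHom h.left) }
      unitIso := NatIso.ofComponents (fun j => Iso.refl j)
      counitIso := NatIso.ofComponents (fun a => CostructuredArrow.isoMk (Iso.refl _)) }
  have : Fintype J := Fintype.ofFinite J
  have : HasColimitsOfShape J (FGModuleCat.{u} k) := hasColimitsOfShape_of_hasFiniteColimits _ J
  exact hasColimitsOfShape_of_equivalence e

/-- The left adjoint of restriction along an order embedding: left Kan extension. -/
noncomputable abbrev induce [Finite X] (f : X ↪o P) : PMod k X ⥤ PMod k P :=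
  f.monotone.functor.lan

variable (X P) in
/-- Order embeddings up to automorphisms of the source. -/
def embSetoid : Setoid (X ↪o P) where
  r f g := ∃ σ : X ≃o X, ∀ x, g x = f (σ x)
  iseqv :=
    { refl f := ⟨OrderIso.refl X, fun _ => rfl⟩
      symm := fun ⟨σ, h⟩ => ⟨σ.symm, fun x => by simp [h]⟩
      trans := fun ⟨σ, h⟩ ⟨τ, h'⟩ => ⟨τ.trans σ, fun x => by simp [h, h']⟩ }

variable (X P) in
/-- The set of order embeddings of `X` into `P` up to automorphisms of `X`. -/
def Emb : Type (max v w) := Quotient (embSetoid X P)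

/-- The class of an order embedding. -/
def Emb.mk (f : X ↪o P) : Emb X P := Quotient.mk (embSetoid X P) f

/-- The invariant `M ↦ dim Hom(U, f^* M)`. -/
noncomputable def dimhAt [Finite X] (f : X ↪o P) (U : PMod k X) : SplitK0 (PMod k P) →+ ℤ :=
  SplitK0.lift (fun M => (Module.finrank k (U ⟶ (restrict k f).obj M) : ℤ))
    (fun _ _ ⟨φ⟩ => by rw [finrank_hom_congr k U ((restrict k f).mapIso φ)])
    (fun M N => by
      rw [finrank_hom_congr k U (nonempty_restrict_biprod_iso k f M N).some, finrank_hom_biprod]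
      push_cast; rfl)

/-- The invariant sending `M` to the multiplicity of `U` in `f^* M`. -/
noncomputable def multAt [Finite X] (f : X ↪o P) (U : PMod k X) (hU : Indecomposable U) :
    SplitK0 (PMod k P) →+ ℤ :=
  SplitK0.lift (fun M => (multiplicityIn U ((restrict k f).obj M) : ℤ))
    (fun _ _ ⟨φ⟩ => by rw [multiplicityIn_congr ((restrict k f).mapIso φ)])
    (fun M N => by
      rw [multiplicityIn_congr (nonempty_restrict_biprod_iso k f M N).some, multiplicityIn_biprod k hU]
      push_cast; rfl)

/-- The invariant `dimh`, for a set `E` of classes of order embeddings and a choice `rep` of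
representatives of these classes. -/
noncomputable def dimh [Finite X] (rep : Emb X P → (X ↪o P)) (E : Set (Emb X P)) :
    SplitK0 (PMod k P) →+ (E × IndClass (PMod k X) → ℤ) :=
  AddMonoidHom.pi fun j => dimhAt k (rep j.1) j.2.1.rep

/-- The invariant `mult`, for a set `E` of classes of order embeddings and a choice `rep` of
representatives of these classes. -/
noncomputable def mult [Finite X] (rep : Emb X P → (X ↪o P)) (E : Set (Emb X P)) :
    SplitK0 (PMod k P) →+ (E × IndClass (PMod k X) → ℤ) :=
  AddMonoidHom.pi fun j => multAt k (rep j.1) j.2.1.rep j.2.2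

/-- The set of isomorphism classes of the modules `f_! U`, for `f` in `E` and `U` an
indecomposable `X`-module. -/
def inducedClasses [Finite X] (rep : Emb X P → (X ↪o P)) (E : Set (Emb X P)) :
    Set (IsoClass (PMod k P)) :=
  {c | ∃ e ∈ E, ∃ U : IndClass (PMod k X), c = IsoClass.mk ((induce k (rep e)).obj U.1.rep)}

end PosetModules

section ThreePointPosets

/-- The poset with elements `1, 2, 3` and relations `1 < 2`, `1 < 3`. -/
inductive VPoset : Type
  | one | two | three

instance : PartialOrder VPoset where
  le a b := a = b ∨ a = .one
  le_refl _ := Or.inl rfl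
  le_trans := by rintro a b c (rfl | rfl) (rfl | rfl) <;> simp
  le_antisymm := by rintro a b (rfl | rfl) (h | rfl) <;> first | rfl | exact h.symm

/-- The poset with elements `1, 2, 3` and relations `1 < 3`, `2 < 3`. -/
inductive LambdaPoset : Type
  | one | two | three

instance : PartialOrder LambdaPoset where
  le a b := a = b ∨ b = .three
  le_refl _ := Or.inl rfl
  le_trans := by rintro a b c (rfl | rfl) (rfl | rfl) <;> simp
  le_antisymm := by rintro a b (rfl | rfl) (h | rfl) <;> first | rfl | exact h.symm

end ThreePointPosets

end PosetModules

open PosetModules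

namespace PosetModules

/-! ### Indecomposables and endomorphism dimensions in Hom-finite linear categories. -/

section GenericCategory

variable {C : Type u} [Category.{v} C] [Preadditive C]

/-! By Frobenius reciprocity (`induceHomEquiv`) the invariant `dimh` at `(f, U)` is `M ↦ dim Hom(f_!
U, M)`. Whether the induced classes form a basis of an invariant depends only on the kernel of the
invariant: their span has to be a complement of it (`IsDetected`, `isInvariantBasis_of_isDetected`).
Freeness is Krull–Schmidt, and `f_! U` is indecomposable because `dim End (f_! U) = dim End U = 1`.

The complement comes from a unitriangular integer pairing (`unitriangular_criterion`). For `1 < 2, 1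
< 3` every indecomposable is thin and supported on a hook, that is, a principal upper set with an
upper set removed. Induction preserves hooks (`nonempty_induce_thin_iso`), and a nonzero morphism
between hooks moves the generator and the removed set in one direction only
(`le_of_hom_hook_ne_zero`). Hence the matrix `dim Hom(H, H')` is unitriangular, and the same order
rules out cycles.

For `1 < 3, 2 < 3` the constant module is not a hook: it needs two generators. But the dimensions of
kernel and cokernel of a linear map differ by an amount fixed by source and target
(`IsLambdaShape.finrank_hom_simple`, `IsLambdaShape.finrank_hom_univ`). So, modulo the functionals
`dim M_p`, each remaining `dim Hom(f_! U, M)` becomes `dim Hom(M, T)`, with `T` thin on a principal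
lower set with a lower set removed. Correcting `[f_! U]` by projective classes in the same way makes
the new pairing unitriangular (`homTo_lambdaClass`).

Finally, `dimh` and `mult` have the same kernel, the elements whose restriction along every
embedding in question vanishes in the split Grothendieck group of `X`. For `mult` this is
Krull–Schmidt (`mult_eq_zero_iff`); for `dimh` it is detection applied to the identity embedding of
`X` (`dimhVanishes_iff`). -/

theorem indecomposable_of_iso [HasBinaryBiproducts C] {U V : C} (φ : U ≅ V)
    (hU : Indecomposable U) : Indecomposable V :=
  ⟨fun h => hU.1 (h.of_iso φ), fun Y Z ψ => hU.2 Y Z (φ ≪≫ ψ)⟩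

theorem finrank_hom_congr_left (k : Type w) [Field k] [Linear k C] {A B : C} (φ : A ≅ B) (U : C) :
    Module.finrank k (A ⟶ U) = Module.finrank k (B ⟶ U) :=
  (Linear.homCongr k φ (Iso.refl U)).finrank_eq

theorem finrank_end_pos (k : Type w) [Field k] [Linear k C] {U : C} [FiniteDimensional k (U ⟶ U)]
    (hU : ¬ IsZero U) : 0 < Module.finrank k (U ⟶ U) := by
  rw [Module.finrank_pos_iff_exists_ne_zero]
  exact ⟨𝟙 U, fun h0 => hU ((IsZero.iff_id_eq_zero U).2 h0)⟩

/-- After composing with `φ.inv`, the morphism `g` is a nonzero scalar. -/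
theorem isIso_of_finrank_end_eq_one (k : Type w) [Field k] [Linear k C] {A B : C} (φ : A ≅ B)
    (hA : Module.finrank k (A ⟶ A) = 1)
    {g : A ⟶ B} (hg : g ≠ 0) : IsIso g := by
  have h1 : (𝟙 A : A ⟶ A) ≠ 0 := fun h => hg (by rw [← Category.id_comp g, h, zero_comp])
  obtain ⟨c, hc⟩ := (finrank_eq_one_iff_of_nonzero' (𝟙 A) h1).1 hA (g ≫ φ.inv)
  have hc0 : c ≠ 0 := by
    rintro rfl
    refine hg ?_
    rw [← cancel_mono φ.inv, ← hc]
    simp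
  have : g = c • φ.hom := by
    rw [← cancel_mono φ.inv, ← hc]
    simp
  rw [this]
  exact ⟨c⁻¹ • φ.inv, by simp [smul_smul, hc0], by simp [smul_smul, hc0]⟩

variable [HasBinaryBiproducts C]

theorem finrank_biprod_hom (k : Type w) [Field k] [Linear k C] (A B U : C)
    [FiniteDimensional k (A ⟶ U)] [FiniteDimensional k (B ⟶ U)] :
    Module.finrank k (A ⊞ B ⟶ U) = Module.finrank k (A ⟶ U) + Module.finrank k (B ⟶ U) := by
  let e : (A ⊞ B ⟶ U) ≃ₗ[k] (A ⟶ U) × (B ⟶ U) :=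
    { toFun f := (biprod.inl ≫ f, biprod.inr ≫ f)
      invFun g := biprod.desc g.1 g.2
      map_add' f g := by simp
      map_smul' c f := by simp
      left_inv f := by ext <;> simp
      right_inv g := by simp }
  rw [e.finrank_eq, Module.finrank_prod]

variable (k : Type w) [Field k] [Linear k C] [∀ A B : C, FiniteDimensional k (A ⟶ B)]

theorem finrank_end_add_le (A B : C) :
    Module.finrank k (A ⟶ A) + Module.finrank k (B ⟶ B) ≤ Module.finrank k (A ⊞ B ⟶ A ⊞ B) := by
  rw [finrank_hom_biprod k, finrank_biprod_hom k, finrank_biprod_hom k]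
  omega

/-- Two nonzero summands would each contribute an identity to the endomorphism space. -/
theorem indecomposable_of_finrank_end_eq_one {U : C} (hU : Module.finrank k (U ⟶ U) = 1) :
    Indecomposable U := by
  refine ⟨fun h => ?_, fun Y Z φ => ?_⟩
  · have : Subsingleton (U ⟶ U) := ⟨fun f g => h.eq_of_src f g⟩
    rw [Module.finrank_zero_of_subsingleton] at hU
    omega
  · by_contra! h
    have h1 := finrank_end_pos k h.1
    have h2 := finrank_end_pos k h.2
    have h3 := finrank_end_add_le k Y Z
    rw [← finrank_hom_congr_left k φ, ← finrank_hom_congr k _ φ] at h3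
    omega

/-- The idempotent `r ≫ i` splits `M`, so it is `0` or `𝟙 M`; the first would make `U` zero. The
classification of indecomposables rests on this. -/
theorem nonempty_iso_of_retract [IsIdempotentComplete C] {U M : C} (hM : Indecomposable M)
    (hU : ¬ IsZero U) (i : U ⟶ M) (r : M ⟶ U) (hir : i ≫ r = 𝟙 U) : Nonempty (M ≅ U) := by
  obtain ⟨Y, Z, j, s, j', s', ⟨φ⟩, hjs, hsj, hjs', hsj'⟩ :=
    exists_split_of_idempotent (r ≫ i) (by simp [reassoc_of% hir])
  rcases hM.2 Y Z φ with h | h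
  · exfalso
    refine hU ((IsZero.iff_id_eq_zero U).2 ?_)
    have : r ≫ i = 0 := by rw [← hsj, h.eq_of_tgt s 0, zero_comp]
    calc 𝟙 U = i ≫ (r ≫ i) ≫ r := by simp [hir]
      _ = 0 := by rw [this]; simp
  · refine ⟨⟨r, i, ?_, hir⟩⟩
    rw [h.eq_of_tgt s' 0, zero_comp] at hsj'
    exact (sub_eq_zero.1 hsj'.symm).symm

/-! ### Krull–Schmidt in the split Grothendieck group. -/

section SplitK0

theorem SplitK0.cls_mk_eq_of_iso {M N : C} (φ : M ≅ N) :
    SplitK0.cls (IsoClass.mk M) = SplitK0.cls (IsoClass.mk N) := by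
  rw [IsoClass.mk_eq_mk_iff.2 ⟨φ⟩]

theorem SplitK0.cls_mk_biprod (M N : C) : SplitK0.cls (IsoClass.mk (M ⊞ N)) =
    SplitK0.cls (IsoClass.mk M) + SplitK0.cls (IsoClass.mk N) := by
  refine (QuotientAddGroup.eq_iff_sub_mem).2 ?_
  exact AddSubgroup.subset_closure ⟨M, N, rfl⟩

theorem SplitK0.closure_cls_eq_top :
    AddSubgroup.closure (Set.range (SplitK0.cls (C := C))) = ⊤ := by
  rw [eq_top_iff]
  rintro x -
  obtain ⟨y, rfl⟩ := QuotientAddGroup.mk'_surjective (splitRelations C) x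
  induction y using FreeAbelianGroup.induction_on with
  | zero => rw [map_zero]; exact zero_mem _
  | of c => exact AddSubgroup.subset_closure ⟨c, rfl⟩
  | neg c h => rw [map_neg]; exact neg_mem h
  | add x y hx hy => rw [map_add]; exact add_mem hx hy

theorem SplitK0.hom_ext {A : Type*} [AddCommGroup A] {φ ψ : SplitK0 C →+ A}
    (h : ∀ M : C, φ (SplitK0.cls (IsoClass.mk M)) = ψ (SplitK0.cls (IsoClass.mk M))) : φ = ψ := by
  refine AddMonoidHom.eq_of_eqOn_dense SplitK0.closure_cls_eq_top ?_
  rintro _ ⟨c, rfl⟩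
  rw [← c.mk_rep]
  exact h _

include k in
/-- Every object is a direct sum of indecomposable objects, so that their classes generate the
split Grothendieck group. -/
theorem SplitK0.closure_indecomposable_eq_top :
    AddSubgroup.closure (SplitK0.cls '' {c : IsoClass C | Indecomposable c.rep}) = ⊤ := by
  rw [eq_top_iff, ← SplitK0.closure_cls_eq_top, AddSubgroup.closure_le]
  rintro _ ⟨c, rfl⟩
  rw [← c.mk_rep]
  generalize c.rep = M
  -- The dimension of the endomorphism space drops strictly on both parts of a nontrivial
  -- decomposition.
  induction hn : Module.finrank k (M ⟶ M) using Nat.strong_induction_on generalizing M with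
  | _ n ih =>
    subst hn
    by_cases hM : Indecomposable M
    · refine AddSubgroup.subset_closure ⟨_, ?_, rfl⟩
      exact indecomposable_of_iso (IsoClass.mk_eq_mk_iff.1 (IsoClass.mk M).mk_rep.symm).some hM
    by_cases hz : IsZero M
    -- A zero object satisfies `[M] = [M] + [M]`, so its class is zero.
    · have e : M ≅ M ⊞ M := hz.iso ((IsZero.iff_id_eq_zero _).2 (by
        ext <;> exact hz.eq_of_src _ _))
      have h := SplitK0.cls_mk_biprod M M
      rw [← SplitK0.cls_mk_eq_of_iso e] at h
      rw [left_eq_add.1 h]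
      exact zero_mem _
    · simp only [Indecomposable, not_and, not_forall, not_or] at hM
      obtain ⟨Y, Z, φ, hY, hZ⟩ := hM hz
      have h1 := finrank_end_pos k hY
      have h2 := finrank_end_pos k hZ
      have h3 := finrank_end_add_le k Y Z
      rw [← finrank_hom_congr_left k φ, ← finrank_hom_congr k _ φ] at h3
      rw [SplitK0.cls_mk_eq_of_iso φ, SplitK0.cls_mk_biprod]
      exact add_mem (ih _ (by omega) Y rfl) (ih _ (by omega) Z rfl)

variable [HasFiniteBiproducts C] [IsIdempotentComplete C]

/-- The homomorphism given by the multiplicity of an indecomposable object. -/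
noncomputable def SplitK0.multHom (U : C) (hU : Indecomposable U) : SplitK0 C →+ ℤ :=
  SplitK0.lift (fun M => (multiplicityIn U M : ℤ))
    (fun _ _ ⟨φ⟩ => by rw [multiplicityIn_congr φ])
    (fun M N => by rw [multiplicityIn_biprod k hU]; push_cast; rfl)

open Classical in
theorem SplitK0.multHom_cls {U : C} (hU : Indecomposable U) {c : IsoClass C}
    (hc : Indecomposable c.rep) :
    SplitK0.multHom k U hU (SplitK0.cls c) = if c = IsoClass.mk U then 1 else 0 := by
  conv_lhs => rw [← c.mk_rep]
  rw [SplitK0.multHom, SplitK0.lift_cls, multiplicityIn_of_indecomposable k hU hc,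
    ← IsoClass.mk_eq_mk_iff, c.mk_rep]
  split_ifs <;> rfl

include k in
-- The multiplicity homomorphisms are a dual family.
theorem SplitK0.linearIndependent_cls (B : Set (IsoClass C))
    (hB : ∀ c ∈ B, Indecomposable c.rep) :
    LinearIndependent ℤ (fun c : B => SplitK0.cls c.1) := by
  refine LinearIndependent.of_pairwise_dual_eq_zero_one _
    (fun c => (SplitK0.multHom k c.1.rep (hB c c.2)).toIntLinearMap) ?_ ?_
  · intro c d hcd
    have : d.1 ≠ c.1 := fun h => hcd (Subtype.ext h.symm)
    simp [SplitK0.multHom_cls k (hB c c.2) (hB d d.2), IsoClass.mk_rep, this]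
  · intro c
    simp [SplitK0.multHom_cls k (hB c c.2) (hB c c.2), IsoClass.mk_rep]

include k in
-- Indecomposable classes generate, and multiplicities read off the coefficients with respect to
-- them.
theorem SplitK0.eq_zero_of_multHom (x : SplitK0 C)
    (hx : ∀ (U : IndClass C), SplitK0.multHom k U.1.rep U.2 x = 0) : x = 0 := by
  have hmem : x ∈ AddSubgroup.closure (SplitK0.cls '' {c : IsoClass C | Indecomposable c.rep}) := by
    rw [SplitK0.closure_indecomposable_eq_top k]; trivial
  rw [Set.image_eq_range, ← Submodule.span_int_eq_addSubgroupClosure,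
    Submodule.mem_toAddSubgroup, Finsupp.mem_span_range_iff_exists_finsupp] at hmem
  obtain ⟨c, rfl⟩ := hmem
  have h0 : c = 0 := by
    ext d
    have := hx ⟨d.1, d.2⟩
    rw [Finsupp.sum, map_sum] at this
    rw [Finsupp.zero_apply, ← this]
    by_cases hd : d ∈ c.support
    · rw [Finset.sum_eq_single d]
      · rw [map_zsmul, SplitK0.multHom_cls k d.2 d.2, IsoClass.mk_rep]
        simp
      · intro b _ hb
        have : b.1 ≠ d.1 := fun h => hb (Subtype.ext h)
        rw [map_zsmul, SplitK0.multHom_cls k d.2 b.2, IsoClass.mk_rep]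
        simp [this]
      · exact fun h => absurd hd h
    · rw [Finsupp.notMem_support_iff.1 hd, eq_comm]
      refine Finset.sum_eq_zero fun b hb => ?_
      have : b.1 ≠ d.1 := fun h => hd (Subtype.ext h ▸ hb)
      rw [map_zsmul, SplitK0.multHom_cls k d.2 b.2, IsoClass.mk_rep]
      simp [this]
  simp [h0]

end SplitK0

end GenericCategory

/-! ### Unitriangular pairings over the integers. -/

section Triangular

variable {G J Q : Type*} [AddCommGroup G] [Finite J] [PartialOrder Q]

/-- A linear extension of `Q` pulls back to a linear order on the indices for which `A` is lower
triangular. -/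
theorem isUnit_det_of_unitriangular {J : Type*} [Fintype J] [DecidableEq J] (t : J → Q)
    (ht : Function.Injective t) (A : Matrix J J ℤ) (hA : ∀ i j, A i j ≠ 0 → t j ≤ t i)
    (h1 : ∀ i, A i i = 1) : IsUnit A.det := by
  let b : J → LinearExtension Q := fun j => toLinearExtension (t j)
  have hb : Function.Injective b := fun i j h => ht h
  let : LinearOrder J := LinearOrder.lift' b hb
  rw [Matrix.det_of_isLowerTriangular A]
  · simp [h1]
  · intro i j hij
    by_contra h
    exact absurd (toLinearExtension.monotone (hA i j h)) (not_le.2 hij)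

/-- A family of functionals that is unitriangular on a family of elements. -/
theorem unitriangular_criterion (t : J → Q) (x : J → G) (Φ : J → G →+ ℤ)
    (hx : ∀ i j, t i = t j → x i = x j) (hΦ : ∀ i j, t i = t j → Φ i = Φ j)
    (hA : ∀ i j, Φ i (x j) ≠ 0 → t j ≤ t i) (h1 : ∀ i, Φ i (x i) = 1) :
    (∀ s ∈ AddSubgroup.closure (Set.range x), (∀ i, Φ i s = 0) → s = 0) ∧
      ∀ g, ∃ s ∈ AddSubgroup.closure (Set.range x), ∀ i, Φ i (g - s) = 0 := by
  classical
  -- Indices at the same position carry the same element and the same functional. Keeping one index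
  -- per position makes the position map injective.
  let J' := Set.range t
  have : Fintype J' := Fintype.ofFinite _
  let c : J' → J := fun q => q.2.choose
  have hc : ∀ q, t (c q) = q := fun q => q.2.choose_spec
  let A : Matrix J' J' ℤ := fun i j => Φ (c i) (x (c j))
  have hdet : IsUnit A.det := isUnit_det_of_unitriangular (fun q : J' => q.1)
    Subtype.val_injective A (fun i j h => by rw [← hc i, ← hc j]; exact hA _ _ h) (fun i => h1 _)
  have hrange : Set.range x = Set.range fun q => x (c q) := by
    ext y
    constructor
    · rintro ⟨j, rfl⟩
      exact ⟨⟨t j, j, rfl⟩, hx _ _ (hc _)⟩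
    · rintro ⟨q, rfl⟩
      exact ⟨_, rfl⟩
  have hall : ∀ g : G, (∀ q, Φ (c q) g = 0) → ∀ i, Φ i g = 0 := fun g h i => by
    rw [hΦ i (c ⟨t i, i, rfl⟩) (hc ⟨t i, i, rfl⟩).symm]
    exact h _
  have hval : ∀ (a : J' → ℤ) (i : J'), Φ (c i) (∑ j, a j • x (c j)) = A.mulVec a i := by
    intro a i
    simp [Matrix.mulVec, dotProduct, A, mul_comm]
  rw [hrange, ← Submodule.span_int_eq_addSubgroupClosure]
  constructor
  · intro s hs h0
    rw [Submodule.mem_toAddSubgroup, Submodule.mem_span_range_iff_exists_fun] at hs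
    obtain ⟨a, rfl⟩ := hs
    have : A.mulVec a = 0 := by
      ext i
      rw [← hval, h0]; rfl
    have ha : a = 0 := by
      rw [← Matrix.one_mulVec a, ← Matrix.nonsing_inv_mul A hdet, ← Matrix.mulVec_mulVec, this,
        Matrix.mulVec_zero]
    simp [ha]
  · intro g
    -- The coefficients solve the linear system for the values on `g`; they are integers since the
    -- determinant is a unit.
    let a : J' → ℤ := A⁻¹.mulVec fun i => Φ (c i) g
    refine ⟨∑ j, a j • x (c j), ?_, hall _ fun i => ?_⟩
    · rw [Submodule.mem_toAddSubgroup, Submodule.mem_span_range_iff_exists_fun]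
      exact ⟨a, rfl⟩
    · rw [map_sub, hval, Matrix.mulVec_mulVec, Matrix.mul_nonsing_inv A hdet, Matrix.one_mulVec,
        sub_self]

end Triangular

/-! ### Thin modules, and morphisms out of hooks and into cohooks. -/

section ThinModules

variable {k : Type u} [Field k] {P : Type w} [PartialOrder P]

/-- The structure map of a module along a relation. -/
def transition (M : PMod k P) {p q : P} (h : p ≤ q) : M.obj p →ₗ[k] M.obj q :=
  (M.map (homOfLE h)).hom.hom

theorem transition_refl (M : PMod k P) (p : P) : transition M (le_refl p) = LinearMap.id := by
  have := M.map_id p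
  exact congrArg (fun g => g.hom.hom) this

theorem transition_transition (M : PMod k P) {p q r : P} (h : p ≤ q) (h' : q ≤ r) (m : M.obj p) :
    transition M h' (transition M h m) = transition M (h.trans h') m := by
  have := M.map_comp (homOfLE h) (homOfLE h')
  exact (congrArg (fun g => g.hom.hom m) this).symm

/-- The component of a morphism at a point. -/
def component {M N : PMod k P} (p : P) : (M ⟶ N) →ₗ[k] (M.obj p →ₗ[k] N.obj p) where
  toFun φ := (φ.app p).hom.hom
  map_add' _ _ := rfl
  map_smul' _ _ := rfl

theorem component_transition {M N : PMod k P} (φ : M ⟶ N) {p q : P} (h : p ≤ q) (m : M.obj p) :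
    component q φ (transition M h m) = transition N h (component p φ m) :=
  congrArg (fun g => g.hom.hom m) (φ.naturality (homOfLE h))

theorem component_comp {L M N : PMod k P} (φ : L ⟶ M) (ψ : M ⟶ N) (p : P) (m : L.obj p) :
    component p (φ ≫ ψ) m = component p ψ (component p φ m) := rfl

theorem component_id {M : PMod k P} (p : P) (m : M.obj p) :
    component p (𝟙 M) m = m := rfl

theorem hom_ext_component {M N : PMod k P} {φ ψ : M ⟶ N}
    (h : ∀ p m, component p φ m = component p ψ m) : φ = ψ := by
  ext p m
  exact h p m

/-- A morphism of modules, given by its components. -/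
def homMk {M N : PMod k P} (f : ∀ p, M.obj p →ₗ[k] N.obj p)
    (hf : ∀ (p q : P) (h : p ≤ q) (m : M.obj p), f q (transition M h m) = transition N h (f p m)) :
    M ⟶ N where
  app p := ObjectProperty.homMk (ModuleCat.ofHom (f p))
  naturality p q h := by
    ext m
    exact hf p q (leOfHom h) m

theorem eq_of_transition_refl (M : PMod k P) {p : P} (m : M.obj p) (h : p ≤ p) :
    transition M h m = m := by
  rw [transition_refl]; rfl

variable (k) in
/-- The space at the point `p` of the thin module supported on `S`. -/
def thinSpace (S : Set P) (p : P) : Submodule k k where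
  carrier := {x | p ∉ S → x = 0}
  add_mem' ha hb h := by rw [ha h, hb h, add_zero]
  zero_mem' _ := rfl
  smul_mem' c x hx h := by rw [hx h, smul_zero]

variable (k) in
open Classical in
/-- The structure maps of the thin module supported on `S`. -/
noncomputable def thinMap (S : Set P) (p q : P) : thinSpace k S p →ₗ[k] thinSpace k S q where
  toFun x := ⟨if q ∈ S then x else 0, fun h => if_neg h⟩
  map_add' x y := by ext; simp only [Submodule.coe_add]; split_ifs <;> simp
  map_smul' c x := by ext; simp

omit [PartialOrder P] in
open Classical in
theorem coe_thinMap (S : Set P) (p q : P) (x : thinSpace k S p) :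
    (thinMap k S p q x : k) = if q ∈ S then (x : k) else 0 := rfl

variable (k) in
/-- The thin module supported on a convex set `S`. -/
noncomputable def thin (S : Set P) (hS : S.OrdConnected) : PMod k P where
  obj p := FGModuleCat.of k (thinSpace k S p)
  map {p q} _ := FGModuleCat.ofHom (thinMap k S p q)
  map_id p := by
    ext x
    change (thinMap k S p p x : k) = x
    rw [coe_thinMap]
    split_ifs with h
    · rfl
    · exact (x.2 h).symm
  map_comp {p q r} f g := by
    ext x
    change (thinMap k S p r x : k) = thinMap k S q r (thinMap k S p q x)
    simp only [coe_thinMap]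
    split_ifs with h h'
    · rfl
    -- Convexity: `r` lies in `S` and `q` does not, so `p` is not in `S` and `x` is zero.
    · exact x.2 fun hp => h' (hS.out hp h ⟨leOfHom f, leOfHom g⟩)
    · rfl

variable {S : Set P} {hS : S.OrdConnected}

/-- The coordinate of a vector in a thin module. -/
noncomputable def thinCoord (p : P) : (thin k S hS).obj p →ₗ[k] k :=
  (thinSpace k S p).subtype

theorem thinCoord_injective (p : P) :
    Function.Injective (thinCoord p : (thin k S hS).obj p →ₗ[k] k) :=
  Subtype.val_injective

theorem thinCoord_eq_zero {p : P} (hp : p ∉ S) (m : (thin k S hS).obj p) : thinCoord p m = 0 :=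
  m.2 hp

theorem thin_eq_zero {p : P} (hp : p ∉ S) (m : (thin k S hS).obj p) : m = 0 :=
  thinCoord_injective p (by rw [thinCoord_eq_zero hp, map_zero])

open Classical in
theorem thinCoord_transition {p q : P} (h : p ≤ q) (m : (thin k S hS).obj p) :
    thinCoord q (transition _ h m) = if q ∈ S then thinCoord p m else 0 := rfl

/-- The vector with a given coordinate. -/
noncomputable def thinVec (p : P) (hp : p ∈ S) : k →ₗ[k] (thin k S hS).obj p where
  toFun x := ⟨x, fun h => absurd hp h⟩
  map_add' _ _ := rfl
  map_smul' _ _ := rfl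

theorem thinCoord_thinVec {p : P} (hp : p ∈ S) (x : k) :
    thinCoord p (thinVec p hp x : (thin k S hS).obj p) = x := rfl

/-- The space of a thin module at a point of its support. -/
noncomputable def thinEquiv (p : P) (hp : p ∈ S) : (thin k S hS).obj p ≃ₗ[k] k where
  __ := thinCoord p
  invFun := thinVec p hp
  left_inv _ := rfl
  right_inv _ := rfl

open Classical in
theorem finrank_thin (p : P) :
    Module.finrank k ((thin k S hS).obj p) = if p ∈ S then 1 else 0 := by
  split_ifs with h
  · rw [(thinEquiv p h).finrank_eq, Module.finrank_self]
  · have : Subsingleton ((thin k S hS).obj p) :=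
      ⟨fun x y => by rw [thin_eq_zero h x, thin_eq_zero h y]⟩
    exact Module.finrank_zero_of_subsingleton

/-- A morphism from a thin module. -/
noncomputable def thinDesc {M : PMod k P} (m : ∀ p, M.obj p) (hm0 : ∀ p ∉ S, m p = 0)
    (hm : ∀ (p q : P) (h : p ≤ q), p ∈ S → transition M h (m p) = m q)
    (hS : S.OrdConnected) : thin k S hS ⟶ M :=
  homMk (fun p => (thinCoord p).smulRight (m p)) (by
    intro p q h x
    by_cases hp : p ∈ S
    · simp only [LinearMap.smulRight_apply, map_smul, hm p q h hp, thinCoord_transition]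
      split_ifs with hq
      · rfl
      · rw [hm0 q hq, smul_zero, smul_zero]
    · simp [thin_eq_zero hp x])

theorem component_thinDesc {M : PMod k P} {m : ∀ p, M.obj p} {hm0 : ∀ p ∉ S, m p = 0}
    {hm : ∀ (p q : P) (h : p ≤ q), p ∈ S → transition M h (m p) = m q} (p : P)
    (x : (thin k S hS).obj p) :
    component p (thinDesc m hm0 hm hS) x = thinCoord p x • m p := rfl

open Classical in
/-- A morphism to a thin module. -/
noncomputable def thinLift {M : PMod k P} (ψ : ∀ p, M.obj p →ₗ[k] k) (hψ0 : ∀ p ∉ S, ψ p = 0)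
    (hψ : ∀ (p q : P) (h : p ≤ q) (m : M.obj p), q ∈ S → ψ q (transition M h m) = ψ p m)
    (hS : S.OrdConnected) : M ⟶ thin k S hS :=
  homMk (fun p => (ψ p).codRestrict (thinSpace k S p) fun m hp => by rw [hψ0 p hp]; rfl) (by
    intro p q h m
    refine thinCoord_injective q ?_
    rw [thinCoord_transition]
    change ψ q _ = if q ∈ S then ψ p m else 0
    split_ifs with hq
    · exact hψ p q h m hq
    · rw [hψ0 q hq]; rfl)

theorem thinCoord_component_thinLift {M : PMod k P} {ψ : ∀ p, M.obj p →ₗ[k] k}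
    {hψ0 : ∀ p ∉ S, ψ p = 0}
    {hψ : ∀ (p q : P) (h : p ≤ q) (m : M.obj p), q ∈ S → ψ q (transition M h m) = ψ p m}
    (p : P) (m : M.obj p) :
    thinCoord p (component p (thinLift ψ hψ0 hψ hS) m) = ψ p m := rfl

theorem not_isZero_thin (hne : S.Nonempty) : ¬ IsZero (thin k S hS) := by
  obtain ⟨p, hp⟩ := hne
  intro h
  have h1 := (IsZero.iff_id_eq_zero _).1 h
  have h2 := congrArg (fun φ => thinCoord p (component p φ (thinVec p hp 1))) h1
  exact one_ne_zero (α := k) h2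

/-- The vectors define a morphism from the thin module to `M`, the functionals one back, and their
pairing makes the composite the identity. -/
theorem nonempty_iso_thin_of_split [Finite P] {M : PMod k P} (hM : Indecomposable M)
    (hS : S.OrdConnected) (hne : S.Nonempty) (m : ∀ p, M.obj p) (hm0 : ∀ p ∉ S, m p = 0)
    (hm : ∀ (p q : P) (h : p ≤ q), p ∈ S → transition M h (m p) = m q)
    (ψ : ∀ p, M.obj p →ₗ[k] k) (hψ0 : ∀ p ∉ S, ψ p = 0)
    (hψ : ∀ (p q : P) (h : p ≤ q) (m : M.obj p), q ∈ S → ψ q (transition M h m) = ψ p m)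
    (h1 : ∀ p ∈ S, ψ p (m p) = 1) : Nonempty (M ≅ thin k S hS) := by
  refine nonempty_iso_of_retract hM (not_isZero_thin hne) (thinDesc m hm0 hm hS)
    (thinLift ψ hψ0 hψ hS) (hom_ext_component fun p x => thinCoord_injective p ?_)
  rw [component_comp, thinCoord_component_thinLift, component_thinDesc, map_smul, component_id]
  by_cases hp : p ∈ S
  · rw [h1 p hp, smul_eq_mul, mul_one]
  · rw [thinCoord_eq_zero hp, zero_smul]

/-- The vectors at `a` that vanish at the points of `W`. -/
def hookSpace (M : PMod k P) (a : P) (W : Set P) : Submodule k (M.obj a) where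
  carrier := {m | ∀ (w : P) (h : a ≤ w), w ∈ W → transition M h m = 0}
  add_mem' hx hy w h hw := by rw [map_add, hx w h hw, hy w h hw, add_zero]
  zero_mem' w h _ := map_zero _
  smul_mem' c x hx w h hw := by rw [map_smul, hx w h hw, smul_zero]

/-- The functionals at `c` that vanish on the images of the points of `D`. -/
def cohookSpace (M : PMod k P) (c : P) (D : Set P) : Submodule k (M.obj c →ₗ[k] k) where
  carrier := {ψ | ∀ (p : P) (h : p ≤ c), p ∈ D → ∀ m, ψ (transition M h m) = 0}
  add_mem' hx hy p h hp m := by rw [LinearMap.add_apply, hx p h hp, hy p h hp, add_zero]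
  zero_mem' _ _ _ _ := rfl
  smul_mem' c x hx p h hp m := by rw [LinearMap.smul_apply, hx p h hp, smul_zero]

/-- `S` is the principal upper set of `a` without the upper set `W`. -/
structure IsHook (S : Set P) (a : P) (W : Set P) : Prop where
  upper : IsUpperSet W
  notMem : a ∉ W
  mem_iff : ∀ p, p ∈ S ↔ a ≤ p ∧ p ∉ W

/-- `S` is the principal lower set of `c` without the lower set `D`. -/
structure IsCohook (S : Set P) (c : P) (D : Set P) : Prop where
  lower : IsLowerSet D
  notMem : c ∉ D
  mem_iff : ∀ p, p ∈ S ↔ p ≤ c ∧ p ∉ D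

variable {a c : P} {W D : Set P}

theorem IsHook.ordConnected (h : IsHook S a W) : S.OrdConnected :=
  ⟨fun x hx y hy z hz => (h.mem_iff z).2 ⟨((h.mem_iff x).1 hx).1.trans hz.1,
    fun hW => ((h.mem_iff y).1 hy).2 (h.upper hz.2 hW)⟩⟩

theorem IsCohook.ordConnected (h : IsCohook S c D) : S.OrdConnected :=
  ⟨fun x hx y hy z hz => (h.mem_iff z).2 ⟨hz.2.trans ((h.mem_iff y).1 hy).1,
    fun hW => ((h.mem_iff x).1 hx).2 (h.lower hz.1 hW)⟩⟩

theorem IsHook.mem (h : IsHook S a W) : a ∈ S := (h.mem_iff a).2 ⟨le_rfl, h.notMem⟩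

theorem IsCohook.mem (h : IsCohook S c D) : c ∈ S := (h.mem_iff c).2 ⟨le_rfl, h.notMem⟩

open Classical in
theorem hookSpace_vec_eq_zero {M : PMod k P} (h : IsHook S a W) (m : hookSpace M a W) (p : P)
    (hp : p ∉ S) : (if hap : a ≤ p then transition M hap m else 0) = 0 := by
  split_ifs with hap
  · exact m.2 p hap (by by_contra hW; exact hp ((h.mem_iff p).2 ⟨hap, hW⟩))
  · rfl

open Classical in
theorem cohookSpace_functional_eq_zero {M : PMod k P} (h : IsCohook S c D)
    (ψ : cohookSpace M c D) (p : P) (hp : p ∉ S) :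
    (if hpc : p ≤ c then ψ.1 ∘ₗ transition M hpc else 0) = 0 := by
  split_ifs with hpc
  · ext m
    exact ψ.2 p hpc (by by_contra hD; exact hp ((h.mem_iff p).2 ⟨hpc, hD⟩)) m
  · rfl

open Classical in
/-- Morphisms from the thin module of a hook. -/
noncomputable def hookEquiv (h : IsHook S a W) (M : PMod k P) :
    (thin k S hS ⟶ M) ≃ₗ[k] hookSpace M a W where
  -- The thin module of a hook is generated by one vector at `a`, whose only relations are that its
  -- images in `W` vanish.
  toFun φ := ⟨component a φ (thinVec a h.mem 1), fun w haw hw => by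
    rw [← component_transition, thin_eq_zero (fun hwS => ((h.mem_iff w).1 hwS).2 hw) (transition _ haw _), map_zero]⟩
  map_add' _ _ := rfl
  map_smul' _ _ := rfl
  invFun m := thinDesc (fun p => if hap : a ≤ p then transition M hap m else 0)
    (hookSpace_vec_eq_zero h m) (fun p q hpq hp => by
      have hap := ((h.mem_iff p).1 hp).1
      rw [dif_pos hap, dif_pos (hap.trans hpq), transition_transition]) hS
  left_inv φ := by
    refine hom_ext_component fun p x => ?_
    rw [component_thinDesc]
    by_cases hp : p ∈ S
    · have hap := ((h.mem_iff p).1 hp).1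
      rw [dif_pos hap, ← component_transition, ← map_smul]
      congr 1
      refine thinCoord_injective p ?_
      rw [map_smul, thinCoord_transition, if_pos hp, thinCoord_thinVec, smul_eq_mul, mul_one]
    · rw [thin_eq_zero hp x, map_zero, map_zero, zero_smul]
  right_inv m := by
    refine Subtype.ext ?_
    change component a (thinDesc _ _ _ _) _ = _
    rw [component_thinDesc, thinCoord_thinVec, one_smul, dif_pos le_rfl, eq_of_transition_refl]

theorem coe_hookEquiv (h : IsHook S a W) {M : PMod k P} (φ : thin k S hS ⟶ M) :
    (hookEquiv h M φ : M.obj a) = component a φ (thinVec a h.mem 1) := rfl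

open Classical in
/-- The morphism to the thin module of a cohook given by a functional. -/
noncomputable def cohookLift (h : IsCohook S c D) (hS : S.OrdConnected) {M : PMod k P}
    (ψ : cohookSpace M c D) : M ⟶ thin k S hS :=
  thinLift (fun p => if hpc : p ≤ c then ψ.1 ∘ₗ transition M hpc else 0)
    (cohookSpace_functional_eq_zero h ψ) (fun p q hpq m hq => by
      have hqc := ((h.mem_iff q).1 hq).1
      rw [dif_pos hqc, dif_pos (hpq.trans hqc), LinearMap.comp_apply, transition_transition]
      rfl) hS

theorem thinCoord_component_cohookLift (h : IsCohook S c D) {M : PMod k P}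
    (ψ : cohookSpace M c D) (p : P) (hp : p ≤ c) (m : M.obj p) :
    thinCoord p (component p (cohookLift h hS ψ) m) = ψ.1 (transition M hp m) := by
  rw [cohookLift, thinCoord_component_thinLift, dif_pos hp, LinearMap.comp_apply]

/-- Morphisms to the thin module of a cohook. -/
noncomputable def cohookEquiv (h : IsCohook S c D) (M : PMod k P) :
    (M ⟶ thin k S hS) ≃ₗ[k] cohookSpace M c D where
  -- Dually, a morphism to a cohook is determined by its coordinate at `c`, which must kill
  -- everything that comes from `D`.
  toFun φ := ⟨thinCoord c ∘ₗ component c φ, fun p hpc hp m => by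
    rw [LinearMap.comp_apply, component_transition,
      thin_eq_zero (fun hpS => ((h.mem_iff p).1 hpS).2 hp) (component p φ m), map_zero, map_zero]⟩
  map_add' _ _ := rfl
  map_smul' _ _ := rfl
  invFun ψ := cohookLift h hS ψ
  left_inv φ := by
    refine hom_ext_component fun p m => thinCoord_injective p ?_
    by_cases hp : p ∈ S
    · have hpc := ((h.mem_iff p).1 hp).1
      rw [thinCoord_component_cohookLift h _ p hpc]
      change thinCoord c (component c φ (transition M hpc m)) = _
      rw [component_transition, thinCoord_transition, if_pos h.mem]
    · rw [thinCoord_eq_zero hp, thinCoord_eq_zero hp]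
  right_inv ψ := by
    refine Subtype.ext (LinearMap.ext fun m => ?_)
    refine (thinCoord_component_cohookLift (hS := hS) h ψ c le_rfl m).trans ?_
    rw [eq_of_transition_refl]

/-- An indecomposable module with a vector and a functional that split off the thin module of an
interval. -/
theorem nonempty_iso_thin_Icc [Finite P] {M : PMod k P} (hM : Indecomposable M) (hac : a ≤ c)
    {m : M.obj a} (hm : m ∈ hookSpace M a {q | ¬ q ≤ c}) {ψ : M.obj c →ₗ[k] k}
    (hψ : ψ ∈ cohookSpace M c {p | ¬ a ≤ p}) (h1 : ψ (transition M hac m) ≠ 0) :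
    Nonempty (M ≅ thin k (Set.Icc a c) Set.ordConnected_Icc) := by
  -- An interval is both a hook at `a` and a cohook at `c`: the vector gives a morphism into `M`,
  -- the functional one out of it, and the composite is determined by its value on the generator.
  have h : IsHook (Set.Icc a c) a {q | ¬ q ≤ c} :=
    ⟨fun x y hxy hx hy => hx (hxy.trans hy), fun h => h hac, fun p => by simp⟩
  have h' : IsCohook (Set.Icc a c) c {p | ¬ a ≤ p} :=
    ⟨fun x y hxy hx hy => hx (hy.trans hxy), fun h => h hac, fun p => by simp [and_comm]⟩
  -- Scaling turns the nonzero value of the composite into `1`.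
  let m' : hookSpace M a {q | ¬ q ≤ c} := ⟨(ψ (transition M hac m))⁻¹ • m, Submodule.smul_mem _ _ hm⟩
  refine nonempty_iso_of_retract hM (not_isZero_thin ⟨a, le_rfl, hac⟩)
    ((hookEquiv h M).symm m') (cohookLift h' Set.ordConnected_Icc ⟨ψ, hψ⟩)
    ((hookEquiv h _).injective (Subtype.ext (thinCoord_injective a ?_)))
  rw [coe_hookEquiv, component_comp, ← coe_hookEquiv h, LinearEquiv.apply_symm_apply,
    thinCoord_component_cohookLift h' _ a hac, map_smul, map_smul, smul_eq_mul,
    inv_mul_cancel₀ h1]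
  rfl

end ThinModules

/-! ### Indecomposable modules over the two three-element posets. -/

section ThreePointClassification

variable {k : Type u} [Field k] {X : Type v} [PartialOrder X]

/-- The relations `x₁ < x₂`, `x₁ < x₃` on a three-element poset. -/
structure IsVShape (x₁ x₂ x₃ : X) : Prop where
  bot_le : ∀ x, x₁ ≤ x
  cover : ∀ x, x = x₁ ∨ x = x₂ ∨ x = x₃
  not_le : ¬ x₂ ≤ x₃
  not_ge : ¬ x₃ ≤ x₂

/-- The relations `x₁ < x₃`, `x₂ < x₃` on a three-element poset. -/
structure IsLambdaShape (x₁ x₂ x₃ : X) : Prop where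
  le_top : ∀ x, x ≤ x₃
  cover : ∀ x, x = x₁ ∨ x = x₂ ∨ x = x₃
  not_le : ¬ x₁ ≤ x₂
  not_ge : ¬ x₂ ≤ x₁

theorem IsVShape.symm {x₁ x₂ x₃ : X} (h : IsVShape x₁ x₂ x₃) : IsVShape x₁ x₃ x₂ :=
  ⟨h.bot_le, fun x => by have := h.cover x; tauto, h.not_ge, h.not_le⟩

theorem IsLambdaShape.symm {x₁ x₂ x₃ : X} (h : IsLambdaShape x₁ x₂ x₃) : IsLambdaShape x₂ x₁ x₃ :=
  ⟨h.le_top, fun x => by have := h.cover x; tauto, h.not_ge, h.not_le⟩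

theorem exists_isVShape (h : Nonempty (X ≃o VPoset)) : ∃ x₁ x₂ x₃ : X, IsVShape x₁ x₂ x₃ := by
  obtain ⟨e⟩ := h
  refine ⟨e.symm .one, e.symm .two, e.symm .three, fun x => ?_, fun x => ?_, ?_, ?_⟩
  · rw [e.symm_apply_le]
    exact Or.inr rfl
  · simp only [e.eq_symm_apply]
    cases e x <;> simp
  · rw [e.symm.le_iff_le]
    rintro (h | h) <;> cases h
  · rw [e.symm.le_iff_le]
    rintro (h | h) <;> cases h

theorem exists_isLambdaShape (h : Nonempty (X ≃o LambdaPoset)) :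
    ∃ x₁ x₂ x₃ : X, IsLambdaShape x₁ x₂ x₃ := by
  obtain ⟨e⟩ := h
  refine ⟨e.symm .one, e.symm .two, e.symm .three, fun x => ?_, fun x => ?_, ?_, ?_⟩
  · rw [e.le_symm_apply]
    exact Or.inr rfl
  · simp only [e.eq_symm_apply]
    cases e x <;> simp
  · rw [e.symm.le_iff_le]
    rintro (h | h) <;> cases h
  · rw [e.symm.le_iff_le]
    rintro (h | h) <;> cases h

theorem exists_functional_ne_zero {V : Type*} [AddCommGroup V] [Module k V] {v : V} (hv : v ≠ 0) :
    ∃ ψ : V →ₗ[k] k, ψ v ≠ 0 := by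
  by_contra! h
  exact hv ((Module.forall_dual_apply_eq_zero_iff k v).1 h)

theorem exists_ne_zero_of_indecomposable {M : PMod k X} (hM : Indecomposable M) :
    ∃ (p : X) (m : M.obj p), m ≠ 0 := by
  by_contra! h
  refine hM.1 ((IsZero.iff_id_eq_zero M).2 (hom_ext_component fun p m => ?_))
  rw [h p m, map_zero, map_zero]

variable [Finite X] {x₁ x₂ x₃ : X} {M : PMod k X}

/-- A nonzero functional on the cokernel, and a vector on which it does not vanish, split off a
simple module. -/
theorem IsVShape.iso_simple_top (hX : IsVShape x₁ x₂ x₃) (hM : Indecomposable M)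
    (h : ¬ Function.Surjective (transition M (hX.bot_le x₂))) :
    Nonempty (M ≅ thin k (Set.Icc x₂ x₂) Set.ordConnected_Icc) := by
  rw [← LinearMap.range_eq_top] at h
  obtain ⟨ψ, hψ, hle⟩ := Submodule.exists_le_ker_of_lt_top _ (lt_top_iff_ne_top.2 h)
  obtain ⟨m, hm⟩ : ∃ m, ψ m ≠ 0 := by
    by_contra! h
    exact hψ (LinearMap.ext h)
  refine nonempty_iso_thin_Icc hM le_rfl (m := m) (ψ := ψ) ?_ ?_ ?_
  · intro w hw hw'
    rcases hX.cover w with rfl | rfl | rfl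
    · exact absurd (hX.bot_le x₂) hw'
    · exact absurd le_rfl hw'
    · exact absurd hw hX.not_le
  · intro p hp hp' m
    rcases hX.cover p with rfl | rfl | rfl
    · exact hle ⟨m, rfl⟩
    · exact absurd le_rfl hp'
    · exact absurd hp hX.not_ge
  · rwa [eq_of_transition_refl]

/-- Nothing lies below `x₁`, so any functional at `x₃` that is nonzero on the image of `m` can be
used. -/
theorem IsVShape.iso_edge (hX : IsVShape x₁ x₂ x₃) (hM : Indecomposable M) {m : M.obj x₁}
    (h : transition M (hX.bot_le x₂) m = 0) (h' : transition M (hX.bot_le x₃) m ≠ 0) :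
    Nonempty (M ≅ thin k (Set.Icc x₁ x₃) Set.ordConnected_Icc) := by
  obtain ⟨ψ, hψ⟩ := exists_functional_ne_zero (k := k) h'
  refine nonempty_iso_thin_Icc hM (hX.bot_le _) (m := m) (ψ := ψ) ?_ ?_ hψ
  · intro w hw hw'
    rcases hX.cover w with rfl | rfl | rfl
    · exact absurd (hX.bot_le x₃) hw'
    · exact h
    · exact absurd le_rfl hw'
  · exact fun p hp hp' => absurd (hX.bot_le p) hp'

theorem IsVShape.iso_simple_bot (hX : IsVShape x₁ x₂ x₃) (hM : Indecomposable M) {m : M.obj x₁}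
    (hm : m ≠ 0) (h : transition M (hX.bot_le x₂) m = 0) (h' : transition M (hX.bot_le x₃) m = 0) :
    Nonempty (M ≅ thin k (Set.Icc x₁ x₁) Set.ordConnected_Icc) := by
  obtain ⟨ψ, hψ⟩ := exists_functional_ne_zero (k := k) hm
  refine nonempty_iso_thin_Icc hM le_rfl (m := m) (ψ := ψ) ?_ ?_ ?_
  · intro w hw hw'
    rcases hX.cover w with rfl | rfl | rfl
    · exact absurd le_rfl hw'
    · exact h
    · exact h'
  · exact fun p hp hp' => absurd (hX.bot_le p) hp'
  · rwa [eq_of_transition_refl]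

/-- A map that is not surjective splits off a simple module at its target. If the maps are
surjective but some nonzero vector dies, an interval starting at `x₁` splits off. Otherwise all maps
are bijective and a line in `M.obj x₁` spans a constant summand. -/
theorem IsVShape.classification (hX : IsVShape x₁ x₂ x₃) (hM : Indecomposable M) :
    (∃ a c : X, a ≤ c ∧ Nonempty (M ≅ thin k (Set.Icc a c) Set.ordConnected_Icc)) ∨
      Nonempty (M ≅ thin k Set.univ Set.ordConnected_univ) := by
  by_cases s2 : Function.Surjective (transition M (hX.bot_le x₂)); swap
  · exact Or.inl ⟨_, _, le_rfl, hX.iso_simple_top hM s2⟩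
  by_cases s3 : Function.Surjective (transition M (hX.bot_le x₃)); swap
  · exact Or.inl ⟨_, _, le_rfl, hX.symm.iso_simple_top hM s3⟩
  have hsurj : ∀ x, Function.Surjective (transition M (hX.bot_le x)) := fun x => by
    rcases hX.cover x with rfl | rfl | rfl
    · exact fun m => ⟨m, eq_of_transition_refl _ _ _⟩
    · exact s2
    · exact s3
  by_cases hinj : ∀ x m, transition M (hX.bot_le x) m = 0 → m = 0
  · right
    have hbij : ∀ x, Function.Bijective (transition M (hX.bot_le x)) :=
      fun x => ⟨(injective_iff_map_eq_zero _).2 (hinj x), hsurj x⟩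
    let e : ∀ x, M.obj x₁ ≃ₗ[k] M.obj x := fun x => LinearEquiv.ofBijective _ (hbij x)
    obtain ⟨p, m, hm⟩ := exists_ne_zero_of_indecomposable hM
    obtain ⟨n, rfl⟩ := hsurj p m
    have hn : n ≠ 0 := fun h => hm (by rw [h, map_zero])
    obtain ⟨ψ, hψ⟩ := exists_functional_ne_zero (k := k) hn
    have he : ∀ (p q : X) (h : p ≤ q) (m : M.obj x₁), transition M h (e p m) = e q m :=
      fun p q h m => transition_transition _ _ _ _
    refine nonempty_iso_thin_of_split hM _ ⟨x₁, trivial⟩ (fun p => e p ((ψ n)⁻¹ • n))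
      (fun p hp => absurd trivial hp) (fun p q h _ => he _ _ _ _)
      (fun p => ψ ∘ₗ (e p).symm.toLinearMap) (fun p hp => absurd trivial hp) ?_ ?_
    · intro p q h m _
      obtain ⟨m, rfl⟩ := (e p).surjective m
      simp [he]
    · intro p _
      simp [hψ]
  · push Not at hinj
    obtain ⟨x, m, hxm, hm⟩ := hinj
    left
    by_cases h2 : transition M (hX.bot_le x₂) m = 0
    · by_cases h3 : transition M (hX.bot_le x₃) m = 0
      · exact ⟨_, _, le_rfl, hX.iso_simple_bot hM hm h2 h3⟩
      · exact ⟨_, _, hX.bot_le _, hX.iso_edge hM h2 h3⟩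
    · refine ⟨_, _, hX.bot_le _, hX.symm.iso_edge hM ?_ h2⟩
      rcases hX.cover x with rfl | rfl | rfl
      · exact absurd ((eq_of_transition_refl _ _ _).symm.trans hxm) hm
      · exact absurd hxm h2
      · exact hxm

theorem IsLambdaShape.iso_simple_bot (hX : IsLambdaShape x₁ x₂ x₃) (hM : Indecomposable M)
    {m : M.obj x₁} (hm : m ≠ 0) (h : transition M (hX.le_top x₁) m = 0) :
    Nonempty (M ≅ thin k (Set.Icc x₁ x₁) Set.ordConnected_Icc) := by
  obtain ⟨ψ, hψ⟩ := exists_functional_ne_zero (k := k) hm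
  refine nonempty_iso_thin_Icc hM le_rfl (m := m) (ψ := ψ) ?_ ?_ ?_
  · intro w hw hw'
    rcases hX.cover w with rfl | rfl | rfl
    · exact absurd le_rfl hw'
    · exact absurd hw hX.not_le
    · exact h
  · intro p hp hp'
    rcases hX.cover p with rfl | rfl | rfl
    · exact absurd le_rfl hp'
    · exact absurd hp hX.not_ge
    · exact absurd (hX.le_top x₁) hp'
  · rwa [eq_of_transition_refl]

/-- A functional separating the image of `m` from the image of the other leg vanishes on whatever
comes from outside the interval. -/
theorem IsLambdaShape.iso_edge (hX : IsLambdaShape x₁ x₂ x₃) (hM : Indecomposable M)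
    {m : M.obj x₁}
    (h : transition M (hX.le_top x₁) m ∉ LinearMap.range (transition M (hX.le_top x₂))) :
    Nonempty (M ≅ thin k (Set.Icc x₁ x₃) Set.ordConnected_Icc) := by
  obtain ⟨ψ, hψ, hle⟩ := Submodule.exists_le_ker_of_notMem h
  refine nonempty_iso_thin_Icc hM (hX.le_top _) (m := m) (ψ := ψ) ?_ ?_ hψ
  · exact fun w hw hw' => absurd (hX.le_top w) hw'
  · intro p hp hp' m
    rcases hX.cover p with rfl | rfl | rfl
    · exact absurd le_rfl hp'
    · exact hle ⟨m, rfl⟩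
    · exact absurd (hX.le_top x₁) hp'

theorem IsLambdaShape.iso_simple_top (hX : IsLambdaShape x₁ x₂ x₃) (hM : Indecomposable M)
    (h : LinearMap.range (transition M (hX.le_top x₁)) ⊔
      LinearMap.range (transition M (hX.le_top x₂)) ≠ ⊤) :
    Nonempty (M ≅ thin k (Set.Icc x₃ x₃) Set.ordConnected_Icc) := by
  obtain ⟨ψ, hψ, hle⟩ := Submodule.exists_le_ker_of_lt_top _ (lt_top_iff_ne_top.2 h)
  obtain ⟨m, hm⟩ : ∃ m, ψ m ≠ 0 := by
    by_contra! h
    exact hψ (LinearMap.ext h)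
  refine nonempty_iso_thin_Icc hM le_rfl (m := m) (ψ := ψ) ?_ ?_ ?_
  · exact fun w hw hw' => absurd (hX.le_top w) hw'
  · intro p hp hp' m
    rcases hX.cover p with rfl | rfl | rfl
    · exact hle (Submodule.mem_sup_left ⟨m, rfl⟩)
    · exact hle (Submodule.mem_sup_right ⟨m, rfl⟩)
    · exact absurd le_rfl hp'
  · rwa [eq_of_transition_refl]

/-- Lifts of a common vector `v` are compatible by injectivity, and a functional that is nonzero on
`v` pulls back to all points. -/
theorem IsLambdaShape.iso_univ (hX : IsLambdaShape x₁ x₂ x₃) (hM : Indecomposable M)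
    (hinj : ∀ x m, transition M (hX.le_top x) m = 0 → m = 0) {v : M.obj x₃} (hv : v ≠ 0)
    (h : ∀ x, ∃ m, transition M (hX.le_top x) m = v) :
    Nonempty (M ≅ thin k Set.univ Set.ordConnected_univ) := by
  choose m hm using h
  obtain ⟨ψ, hψ⟩ := exists_functional_ne_zero (k := k) hv
  refine nonempty_iso_thin_of_split hM _ ⟨x₁, trivial⟩ m
    (fun p hp => absurd trivial hp) (fun p q h _ => ?_)
    (fun p => (ψ v)⁻¹ • ψ ∘ₗ transition M (hX.le_top p)) (fun p hp => absurd trivial hp) ?_ ?_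
  · rw [← sub_eq_zero]
    refine hinj q _ ?_
    rw [map_sub, transition_transition, hm, hm, sub_self]
  · intro p q h m _
    simp only [LinearMap.smul_apply, LinearMap.comp_apply, transition_transition]
  · intro p _
    simp [hm, hψ]

theorem IsLambdaShape.iso_of_ne_zero (hX : IsLambdaShape x₁ x₂ x₃) (hM : Indecomposable M)
    (hinj : ∀ x m, transition M (hX.le_top x) m = 0 → m = 0) {m : M.obj x₁} (hm : m ≠ 0) :
    Nonempty (M ≅ thin k (Set.Icc x₁ x₃) Set.ordConnected_Icc) ∨
      Nonempty (M ≅ thin k Set.univ Set.ordConnected_univ) := by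
  by_cases h : transition M (hX.le_top x₁) m ∈ LinearMap.range (transition M (hX.le_top x₂))
  · obtain ⟨n, hn⟩ := h
    refine Or.inr (hX.iso_univ hM hinj (fun h => hm (hinj _ _ h)) fun x => ?_)
    rcases hX.cover x with rfl | rfl | rfl
    · exact ⟨_, rfl⟩
    · exact ⟨n, hn⟩
    · exact ⟨_, eq_of_transition_refl _ _ _⟩
  · exact Or.inl (hX.iso_edge hM h)

/-- Nonzero kernels, and a top space not spanned by the two images, split off simple modules.
Otherwise a nonzero vector at a minimal point maps either into the image of the other leg, giving
the constant module, or outside it, giving an interval. Without such a vector `M` would vanish. -/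
theorem IsLambdaShape.classification (hX : IsLambdaShape x₁ x₂ x₃) (hM : Indecomposable M) :
    (∃ a c : X, a ≤ c ∧ Nonempty (M ≅ thin k (Set.Icc a c) Set.ordConnected_Icc)) ∨
      Nonempty (M ≅ thin k Set.univ Set.ordConnected_univ) := by
  by_cases hinj : ∀ x m, transition M (hX.le_top x) m = 0 → m = 0; swap
  · push Not at hinj
    obtain ⟨x, m, hxm, hm⟩ := hinj
    rcases hX.cover x with rfl | rfl | rfl
    · exact Or.inl ⟨_, _, le_rfl, hX.iso_simple_bot hM hm hxm⟩
    · exact Or.inl ⟨_, _, le_rfl, hX.symm.iso_simple_bot hM hm hxm⟩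
    · exact absurd ((eq_of_transition_refl _ _ _).symm.trans hxm) hm
  by_cases htop : LinearMap.range (transition M (hX.le_top x₁)) ⊔
      LinearMap.range (transition M (hX.le_top x₂)) = ⊤; swap
  · exact Or.inl ⟨_, _, le_rfl, hX.iso_simple_top hM htop⟩
  by_cases h1 : ∃ m : M.obj x₁, m ≠ 0
  · obtain ⟨m, hm⟩ := h1
    exact (hX.iso_of_ne_zero hM hinj hm).imp (fun h => ⟨_, _, hX.le_top _, h⟩) id
  by_cases h2 : ∃ m : M.obj x₂, m ≠ 0
  · obtain ⟨m, hm⟩ := h2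
    exact (hX.symm.iso_of_ne_zero hM hinj hm).imp (fun h => ⟨_, _, hX.le_top _, h⟩) id
  push Not at h1 h2
  exfalso
  obtain ⟨p, m, hm⟩ := exists_ne_zero_of_indecomposable hM
  refine hm (hinj p m ?_)
  have : transition M (hX.le_top p) m ∈ (⊤ : Submodule k (M.obj x₃)) := trivial
  rw [← htop, Submodule.mem_sup] at this
  obtain ⟨_, ⟨y, rfl⟩, _, ⟨z, rfl⟩, hyz⟩ := this
  rw [← hyz, h1 y, h2 z, map_zero, map_zero, add_zero]

end ThreePointClassification

/-! ### Induction along an order embedding. -/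

section InducedModules

variable {k : Type u} [Field k] {X : Type v} [PartialOrder X] {P : Type w} [PartialOrder P]

variable [Finite X] (f : X ↪o P)

/-- The adjunction between induction and restriction. -/
noncomputable def induceAdjunction : induce k f ⊣ restrict k f :=
  f.monotone.functor.lanAdjunction (FGModuleCat.{u} k)

/-- Frobenius reciprocity. -/
noncomputable def induceHomEquiv (U : PMod k X) (M : PMod k P) :
    ((induce k f).obj U ⟶ M) ≃ₗ[k] (U ⟶ (restrict k f).obj M) where
  __ := (induceAdjunction f).homEquiv U M
  map_add' φ ψ := by
    simp only [Equiv.toFun_as_coe, Adjunction.homEquiv_unit]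
    exact Preadditive.comp_add _ _ _ _ ((restrict k f).map φ) ((restrict k f).map ψ)
  map_smul' c φ := by
    simp only [Equiv.toFun_as_coe, Adjunction.homEquiv_unit]
    exact Linear.comp_smul _ _ _ _ c ((restrict k f).map φ)

theorem induceHomEquiv_comp {U : PMod k X} {M N : PMod k P} (φ : (induce k f).obj U ⟶ M)
    (ψ : M ⟶ N) :
    induceHomEquiv f U N (φ ≫ ψ) = induceHomEquiv f U M φ ≫ (restrict k f).map ψ :=
  (induceAdjunction f).homEquiv_naturality_right φ ψ

/-- An order embedding is a fully faithful functor, so the unit of left Kan extension is invertible.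
-/
theorem nonempty_iso_restrict_induce (U : PMod k X) :
    Nonempty (U ≅ (restrict k f).obj ((induce k f).obj U)) := by
  have : f.monotone.functor.Full := ⟨fun {x y} h => ⟨homOfLE (f.le_iff_le.1 (leOfHom h)), rfl⟩⟩
  have : f.monotone.functor.Faithful := ⟨fun _ => Subsingleton.elim _ _⟩
  have : IsIso ((f.monotone.functor.lanAdjunction (FGModuleCat.{u} k)).unit.app U) := inferInstance
  exact ⟨asIso ((f.monotone.functor.lanAdjunction (FGModuleCat.{u} k)).unit.app U)⟩

theorem finrank_end_induce (U : PMod k X) :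
    Module.finrank k ((induce k f).obj U ⟶ (induce k f).obj U) = Module.finrank k (U ⟶ U) := by
  rw [(induceHomEquiv f U _).finrank_eq,
    finrank_hom_congr k U (nonempty_iso_restrict_induce f U).some]

omit [Finite X] in
/-- The upper set generated by the images of the points of `W` above `a`. -/
def pushUpper (a : X) (W : Set X) : Set P := {p | ∃ w ∈ W, a ≤ w ∧ f w ≤ p}

/-- The lower set generated by the images of the points of `D` below `c`. -/
def pushLower (c : X) (D : Set X) : Set P := {p | ∃ d ∈ D, d ≤ c ∧ p ≤ f d}

variable {f} {a c : X} {W D : Set X}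

omit [Finite X] in
theorem isHook_pushUpper {S : Set X} (h : IsHook S a W) :
    IsHook (Set.Ici (f a) \ pushUpper f a W) (f a) (pushUpper f a W) where
  upper := fun _ _ hpq ⟨_, hw, haw, hp⟩ => ⟨_, hw, haw, hp.trans hpq⟩
  notMem := fun ⟨_, hw, haw, hwa⟩ =>
    h.notMem (le_antisymm haw (f.le_iff_le.1 hwa) ▸ hw)
  mem_iff _ := Iff.rfl

omit [Finite X] in
-- A vector that dies at `f w` dies at every point above it.
theorem hookSpace_restrict (M : PMod k P) (a : X) (W : Set X) :
    hookSpace ((restrict k f).obj M) a W = hookSpace M (f a) (pushUpper f a W) := by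
  ext m
  constructor
  · rintro h p hp ⟨w, hw, haw, hwp⟩
    refine (transition_transition M (f.monotone haw) hwp m).symm.trans ?_
    exact (congrArg _ (h w haw hw)).trans (map_zero _)
  · exact fun h w haw hw => h (f w) (f.monotone haw) ⟨w, hw, haw, le_rfl⟩

omit [Finite X] in
theorem cohookSpace_restrict (M : PMod k P) (c : X) (D : Set X) :
    cohookSpace ((restrict k f).obj M) c D = cohookSpace M (f c) (pushLower f c D) := by
  ext ψ
  constructor
  · rintro h p hp ⟨d, hd, hdc, hpd⟩ m
    rw [← transition_transition M hpd (f.monotone hdc)]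
    exact h d hdc hd _
  · exact fun h d hdc hd m => h (f d) (f.monotone hdc) ⟨d, hd, hdc, le_rfl⟩ m

/-- Induction of the thin module of a hook. -/
theorem nonempty_induce_thin_iso {S : Set X} {hS : S.OrdConnected} (h : IsHook S a W) :
    Nonempty ((induce k f).obj (thin k S hS) ≅
      thin k (Set.Ici (f a) \ pushUpper f a W) (isHook_pushUpper h).ordConnected) := by
  -- Both modules corepresent the vectors at `f a` that die on the pushed upper set. With naturality
  -- in `M`, Yoneda gives the isomorphism.
  let e : ∀ M : PMod k P, ((induce k f).obj (thin k S hS) ⟶ M) ≃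
      (thin k (Set.Ici (f a) \ pushUpper f a W) (isHook_pushUpper h).ordConnected ⟶ M) := fun M =>
    ((induceHomEquiv f _ M).trans (hookEquiv h _)).toEquiv.trans
      ((Equiv.setCongr (congrArg SetLike.coe (hookSpace_restrict M a W))).trans
      (hookEquiv (isHook_pushUpper h) M).symm.toEquiv)
  have he : ∀ (M : PMod k P) φ, component (f a) (e M φ) (thinVec (f a) (isHook_pushUpper h).mem 1) =
      component a (induceHomEquiv f _ M φ) (thinVec a h.mem 1) := fun M φ =>
    congrArg Subtype.val ((hookEquiv (hS := (isHook_pushUpper h).ordConnected)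
      (isHook_pushUpper h) M).apply_symm_apply _)
  have hnat : ∀ {M N : PMod k P} φ (g : M ⟶ N), e N (φ ≫ g) = e M φ ≫ g := fun φ g => by
    refine (hookEquiv (isHook_pushUpper h) _).injective (Subtype.ext ?_)
    rw [coe_hookEquiv, coe_hookEquiv, he, component_comp, he, induceHomEquiv_comp]
    rfl
  refine ⟨Coyoneda.ext _ _ (fun {M} => e M) (fun {M} => (e M).symm) (fun {M} => (e M).left_inv)
    (fun {M} => (e M).right_inv) fun {M N} φ g => ?_⟩
  rw [Equiv.symm_apply_eq, hnat, Equiv.apply_symm_apply]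

/-- The functional `M ↦ dim Hom(H, M)`. -/
noncomputable def homFrom [Finite P] (H : PMod k P) : SplitK0 (PMod k P) →+ ℤ :=
  SplitK0.lift (fun M => (Module.finrank k (H ⟶ M) : ℤ))
    (fun _ _ ⟨φ⟩ => by rw [finrank_hom_congr k H φ])
    (fun M N => by rw [finrank_hom_biprod]; push_cast; rfl)

/-- The functional `M ↦ dim Hom(M, T)`. -/
noncomputable def homTo [Finite P] (T : PMod k P) : SplitK0 (PMod k P) →+ ℤ :=
  SplitK0.lift (fun M => (Module.finrank k (M ⟶ T) : ℤ))
    (fun _ _ ⟨φ⟩ => by rw [finrank_hom_congr_left k φ])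
    (fun M N => by rw [finrank_biprod_hom]; push_cast; rfl)

theorem homFrom_congr [Finite P] {H H' : PMod k P} (φ : H ≅ H') : homFrom H = homFrom H' :=
  SplitK0.hom_ext fun M => by
    rw [homFrom, homFrom, SplitK0.lift_cls, SplitK0.lift_cls, finrank_hom_congr_left k φ]

theorem dimhAt_eq_homFrom [Finite P] (U : PMod k X) :
    dimhAt k f U = homFrom ((induce k f).obj U) :=
  SplitK0.hom_ext fun M => by
    rw [homFrom, dimhAt, SplitK0.lift_cls, SplitK0.lift_cls, (induceHomEquiv f U M).finrank_eq]

theorem dimhAt_congr {U V : PMod k X} (φ : U ≅ V) :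
    (dimhAt k f U : SplitK0 (PMod k P) →+ ℤ) = dimhAt k f V :=
  SplitK0.hom_ext fun M => by
    rw [dimhAt, dimhAt, SplitK0.lift_cls, SplitK0.lift_cls, finrank_hom_congr_left k φ]

section Restriction

variable (f)

/-- Restriction on split Grothendieck groups. -/
noncomputable def restrictK0 : SplitK0 (PMod k P) →+ SplitK0 (PMod k X) :=
  SplitK0.lift (fun M => SplitK0.cls (IsoClass.mk ((restrict k f).obj M)))
    (fun _ _ ⟨φ⟩ => SplitK0.cls_mk_eq_of_iso ((restrict k f).mapIso φ))
    (fun M N => by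
      rw [SplitK0.cls_mk_eq_of_iso (nonempty_restrict_biprod_iso k f M N).some,
        SplitK0.cls_mk_biprod])

/-- Together with `multAt_eq_comp`: both invariants see `M` only through the class of `f^* M`, where
they can be compared. -/
theorem dimhAt_eq_comp (U : PMod k X) :
    (dimhAt k f U : SplitK0 (PMod k P) →+ ℤ) = (homFrom U).comp (restrictK0 f) :=
  SplitK0.hom_ext fun M => by
    rw [AddMonoidHom.comp_apply, dimhAt, restrictK0, homFrom, SplitK0.lift_cls, SplitK0.lift_cls,
      SplitK0.lift_cls]

theorem multAt_eq_comp (U : PMod k X) (hU : Indecomposable U) :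
    (multAt k f U hU : SplitK0 (PMod k P) →+ ℤ) =
      (SplitK0.multHom k U hU).comp (restrictK0 f) :=
  SplitK0.hom_ext fun M => by
    rw [AddMonoidHom.comp_apply, multAt, restrictK0, SplitK0.multHom, SplitK0.lift_cls,
      SplitK0.lift_cls, SplitK0.lift_cls]

theorem dimhAt_refl (U : PMod k X) :
    dimhAt k (RelEmbedding.refl (· ≤ ·)) U = homFrom U :=
  SplitK0.hom_ext fun M => by
    rw [dimhAt, homFrom, SplitK0.lift_cls, SplitK0.lift_cls]
    rfl

end Restriction

end InducedModules

/-! ### Reduction to a complement of the kernel; comparison of `dimh` and `mult`. -/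

section Reduction

variable (k : Type u) [Field k] {X : Type v} [PartialOrder X] [Finite X]
  {P : Type w} [PartialOrder P]

/-- The isomorphism classes of the modules induced from indecomposable modules along the
embeddings in `F`. -/
def inducedSet (F : Set (X ↪o P)) : Set (IsoClass (PMod k P)) :=
  {c | ∃ f ∈ F, ∃ U : PMod k X, Indecomposable U ∧ c = IsoClass.mk ((induce k f).obj U)}

theorem inducedClasses_eq (rep : Emb X P → (X ↪o P)) (E : Set (Emb X P)) :
    inducedClasses k rep E = inducedSet k (rep '' E) := by
  ext c
  constructor
  · rintro ⟨e, he, U, rfl⟩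
    exact ⟨_, ⟨e, he, rfl⟩, U.1.rep, U.2, rfl⟩
  · rintro ⟨_, ⟨e, he, rfl⟩, U, hU, rfl⟩
    have φ := (IsoClass.mk_eq_mk_iff.1 (IsoClass.mk U).mk_rep).some
    exact ⟨e, he, ⟨IsoClass.mk U, indecomposable_of_iso φ.symm hU⟩,
      IsoClass.mk_eq_mk_iff.2 ⟨(induce k (rep e)).mapIso φ.symm⟩⟩

/-- An element of the split Grothendieck group is annihilated by the invariants `dimh` of the
embeddings in `F`. -/
def DimhVanishes (F : Set (X ↪o P)) (g : SplitK0 (PMod k P)) : Prop :=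
  ∀ f ∈ F, ∀ U : PMod k X, Indecomposable U → dimhAt k f U g = 0

/-- The subgroup generated by the induced classes is a complement of the common kernel of the
invariants `dimh`. -/
structure IsDetected (F : Set (X ↪o P)) : Prop where
  injective : ∀ s ∈ AddSubgroup.closure (SplitK0.cls '' inducedSet k F),
    DimhVanishes k F s → s = 0
  surjective : ∀ g, ∃ s ∈ AddSubgroup.closure (SplitK0.cls '' inducedSet k F),
    DimhVanishes k F (g - s)

variable {k}

theorem nonempty_iso_induce_refl (U : PMod k X) :
    Nonempty (U ≅ (induce k (RelEmbedding.refl (· ≤ ·) : X ↪o X)).obj U) := by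
  obtain ⟨φ⟩ := nonempty_iso_restrict_induce (RelEmbedding.refl (· ≤ ·) : X ↪o X) U
  exact ⟨φ⟩

/-- Induction along the identity yields every indecomposable `X`-module, so detection for the
identity makes Hom dimensions separate the whole split Grothendieck group of `X`. -/
theorem eq_zero_of_homFrom (hX : IsDetected k {(RelEmbedding.refl (· ≤ ·) : X ↪o X)})
    (g : SplitK0 (PMod k X)) (hg : ∀ U : PMod k X, Indecomposable U → homFrom U g = 0) :
    g = 0 := by
  refine hX.injective g ?_ ?_
  · have h : g ∈ (⊤ : AddSubgroup (SplitK0 (PMod k X))) := trivial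
    rw [← SplitK0.closure_indecomposable_eq_top k] at h
    refine AddSubgroup.closure_mono (Set.image_mono ?_) h
    intro c hc
    exact ⟨_, rfl, c.rep, hc, c.mk_rep.symm.trans
      (IsoClass.mk_eq_mk_iff.2 (nonempty_iso_induce_refl c.rep))⟩
  · rintro f rfl U hU
    rw [dimhAt_refl]
    exact hg U hU

theorem dimhVanishes_iff (hX : IsDetected k {(RelEmbedding.refl (· ≤ ·) : X ↪o X)})
    (F : Set (X ↪o P)) (g : SplitK0 (PMod k P)) :
    DimhVanishes k F g ↔ ∀ f ∈ F, restrictK0 f g = 0 := by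
  refine forall₂_congr fun f _ => ⟨fun h => eq_zero_of_homFrom hX _ fun U hU => ?_, fun h U _ => ?_⟩
  · rw [← AddMonoidHom.comp_apply, ← dimhAt_eq_comp]
    exact h U hU
  · rw [dimhAt_eq_comp, AddMonoidHom.comp_apply, h, map_zero]

theorem dimh_eq_zero_iff (rep : Emb X P → (X ↪o P)) (E : Set (Emb X P))
    (g : SplitK0 (PMod k P)) : dimh k rep E g = 0 ↔ DimhVanishes k (rep '' E) g := by
  rw [funext_iff]
  constructor
  · rintro h _ ⟨e, he, rfl⟩ U hU
    have φ := (IsoClass.mk_eq_mk_iff.1 (IsoClass.mk U).mk_rep).some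
    rw [← dimhAt_congr φ]
    exact h ⟨⟨e, he⟩, ⟨_, indecomposable_of_iso φ.symm hU⟩⟩
  · exact fun h ⟨e, U⟩ => h _ ⟨e.1, e.2, rfl⟩ _ U.2

theorem mult_eq_zero_iff (rep : Emb X P → (X ↪o P)) (E : Set (Emb X P))
    (g : SplitK0 (PMod k P)) :
    mult k rep E g = 0 ↔ ∀ f ∈ rep '' E, restrictK0 f g = 0 := by
  rw [funext_iff]
  constructor
  · rintro h _ ⟨e, he, rfl⟩
    refine SplitK0.eq_zero_of_multHom k _ fun U => ?_
    rw [← AddMonoidHom.comp_apply, ← multAt_eq_comp]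
    exact h ⟨⟨e, he⟩, U⟩
  · intro h ⟨e, U⟩
    change multAt k _ _ U.2 g = 0
    rw [multAt_eq_comp, AddMonoidHom.comp_apply, h _ ⟨e.1, e.2, rfl⟩, map_zero]

/-- Only the kernel of `Ψ` matters: a subgroup maps bijectively onto the image exactly when it is a
complement of the kernel. The image is finitely generated as a subgroup of `ℤ^J` with `J` finite. -/
theorem isInvariantBasis_of_isDetected [Finite P] {F : Set (X ↪o P)} (hF : IsDetected k F)
    (hend : ∀ U : PMod k X, Indecomposable U → Module.finrank k (U ⟶ U) = 1)
    {J : Type*} [Finite J] (Ψ : SplitK0 (PMod k P) →+ (J → ℤ))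
    (hΨ : ∀ g, Ψ g = 0 ↔ DimhVanishes k F g) : IsInvariantBasis Ψ (inducedSet k F) := by
  have hindec : ∀ c ∈ inducedSet k F, Indecomposable c.rep := by
    rintro _ ⟨f, -, U, hU, rfl⟩
    refine indecomposable_of_iso (IsoClass.mk_eq_mk_iff.1 (IsoClass.mk_rep _).symm).some ?_
    exact indecomposable_of_finrank_end_eq_one k ((finrank_end_induce f U).trans (hend U hU))
  refine ⟨?_, hindec, SplitK0.linearIndependent_cls k _ hindec, ?_, ?_⟩
  · have : Ψ.range = (LinearMap.range Ψ.toIntLinearMap).toAddSubgroup := rfl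
    rw [this, ← Submodule.fg_iff_addSubgroup_fg]
    exact IsNoetherian.noetherian _
  · rw [injective_iff_map_eq_zero]
    rintro ⟨s, hs⟩ h
    refine Subtype.ext (hF.injective s hs ((hΨ s).1 ?_))
    exact congrArg Subtype.val h
  · rintro ⟨_, g, rfl⟩
    obtain ⟨s, hs, h⟩ := hF.surjective g
    refine ⟨⟨s, hs⟩, Subtype.ext ?_⟩
    rw [← hΨ, map_sub, sub_eq_zero] at h
    exact h.symm

theorem isInvariantBasis_dimh_mult [Finite P] [Finite (IndClass (PMod k X))]
    (hX : IsDetected k {(RelEmbedding.refl (· ≤ ·) : X ↪o X)})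
    (hend : ∀ U : PMod k X, Indecomposable U → Module.finrank k (U ⟶ U) = 1)
    (rep : Emb X P → (X ↪o P)) (E : Set (Emb X P)) (hF : IsDetected k (rep '' E)) :
    IsInvariantBasis (dimh k rep E) (inducedClasses k rep E) ∧
      IsInvariantBasis (mult k rep E) (inducedClasses k rep E) := by
  have : Finite (X ↪o P) := Finite.of_injective (fun f x => f x) DFunLike.coe_injective
  have : Finite (Emb X P) := Quotient.finite _
  rw [inducedClasses_eq]
  exact ⟨isInvariantBasis_of_isDetected hF hend _ fun g => dimh_eq_zero_iff rep E g,
    isInvariantBasis_of_isDetected hF hend _ fun g =>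
      (mult_eq_zero_iff rep E g).trans (dimhVanishes_iff hX _ g).symm⟩

end Reduction

/-! ### Hom dimensions between thin modules. -/

section HomDimensions

variable {k : Type u} [Field k] {P : Type w} [PartialOrder P] {S T : Set P}
  {hS : S.OrdConnected} {hT : T.OrdConnected} {a c : P} {W D : Set P}

open Classical in
-- The space at `a` has dimension at most one, so the vanishing conditions keep all of it or none.
theorem finrank_hookSpace_thin :
    Module.finrank k (hookSpace (thin k T hT) a W) =
      if a ∈ T ∧ ∀ w ∈ W, a ≤ w → w ∉ T then 1 else 0 := by
  split_ifs with h
  · have : hookSpace (thin k T hT) a W = ⊤ :=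
      eq_top_iff.2 fun m _ w haw hw => thin_eq_zero (h.2 w hw haw) _
    rw [this, finrank_top, finrank_thin, if_pos h.1]
  · have : hookSpace (thin k T hT) a W = ⊥ := eq_bot_iff.2 fun m hm => by
      by_cases ha : a ∈ T
      · push Not at h
        obtain ⟨w, hw, haw, hwT⟩ := h ha
        have h0 := congrArg (thinCoord w) (hm w haw hw)
        rw [thinCoord_transition, if_pos hwT, map_zero] at h0
        exact thinCoord_injective a (h0.trans (map_zero _).symm)
      · exact thin_eq_zero ha m
    rw [this, finrank_bot]

open Classical in
theorem finrank_cohookSpace_thin :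
    Module.finrank k (cohookSpace (thin k T hT) c D) =
      if c ∈ T ∧ ∀ d ∈ D, d ≤ c → d ∉ T then 1 else 0 := by
  split_ifs with h
  · have : cohookSpace (thin k T hT) c D = ⊤ := eq_top_iff.2 fun ψ _ d hdc hd m => by
      rw [thin_eq_zero (h.2 d hd hdc) m, map_zero, map_zero]
    rw [this, finrank_top]
    exact (Subspace.dual_finrank_eq).trans ((finrank_thin c).trans (if_pos h.1))
  · have : cohookSpace (thin k T hT) c D = ⊥ := eq_bot_iff.2 fun ψ hψ => by
      refine LinearMap.ext fun m => ?_
      by_cases hc : c ∈ T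
      · push Not at h
        obtain ⟨d, hd, hdc, hdT⟩ := h hc
        have h0 := hψ d hdc hd (thinVec d hdT (thinCoord c m))
        -- Since `c` and `d` both lie in `T`, every vector at `c` comes from `d`, where the
        -- functional must vanish.
        have h1 : transition (thin k T hT) hdc (thinVec d hdT (thinCoord c m)) = m :=
          thinCoord_injective c (by rw [thinCoord_transition, if_pos hc, thinCoord_thinVec])
        rwa [h1] at h0
      · rw [thin_eq_zero hc m, map_zero, map_zero]
    rw [this, finrank_bot]

theorem finrank_end_thin_hook (h : IsHook S a W) :
    Module.finrank k (thin k S hS ⟶ thin k S hS) = 1 := by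
  rw [(hookEquiv h _).finrank_eq, finrank_hookSpace_thin, if_pos]
  exact ⟨h.mem, fun w hw _ hwS => ((h.mem_iff w).1 hwS).2 hw⟩

theorem finrank_end_thin_cohook (h : IsCohook S c D) :
    Module.finrank k (thin k S hS ⟶ thin k S hS) = 1 := by
  rw [(cohookEquiv h _).finrank_eq, finrank_cohookSpace_thin, if_pos]
  exact ⟨h.mem, fun w hw _ hwS => ((h.mem_iff w).1 hwS).2 hw⟩

theorem isHook_Icc (hac : a ≤ c) : IsHook (Set.Icc a c) a {q | ¬ q ≤ c} :=
  ⟨fun _ _ hxy hx hy => hx (hxy.trans hy), fun h => h hac, fun p => by simp⟩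

theorem isHook_univ (h : ∀ p, a ≤ p) : IsHook Set.univ a ∅ :=
  ⟨fun _ _ _ h => h, id, fun p => by simp [h]⟩

theorem isCohook_univ (h : ∀ p, p ≤ c) : IsCohook Set.univ c ∅ :=
  ⟨fun _ _ _ h => h, id, fun p => by simp [h]⟩

theorem indecomposable_thin_hook [Finite P] (h : IsHook S a W) : Indecomposable (thin k S hS) :=
  indecomposable_of_finrank_end_eq_one k (finrank_end_thin_hook h)

theorem thin_congr (h : S = T) : thin k S hS = thin k T hT := by subst h; rfl

theorem finite_indClass [Finite P]
    (h : ∀ M : PMod k P, Indecomposable M →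
      (∃ a c : P, a ≤ c ∧ Nonempty (M ≅ thin k (Set.Icc a c) Set.ordConnected_Icc)) ∨
        Nonempty (M ≅ thin k Set.univ Set.ordConnected_univ)) :
    Finite (IndClass (PMod k P)) := by
  let φ : Option (P × P) → IsoClass (PMod k P) := fun o => o.elim
    (IsoClass.mk (thin k Set.univ Set.ordConnected_univ))
    fun p => IsoClass.mk (thin k (Set.Icc p.1 p.2) Set.ordConnected_Icc)
  have hφ : ∀ U : IndClass (PMod k P), U.1 ∈ Set.range φ := fun U => by
    rw [← U.1.mk_rep]
    rcases h U.1.rep U.2 with ⟨a, c, -, hU⟩ | hU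
    · exact ⟨some (a, c), (IsoClass.mk_eq_mk_iff.2 hU).symm⟩
    · exact ⟨none, (IsoClass.mk_eq_mk_iff.2 hU).symm⟩
  exact Finite.of_injective (fun U => (⟨U.1, hφ U⟩ : Set.range φ))
    fun U V h => Subtype.ext (congrArg (fun c : Set.range φ => c.1) h)

/-- The generator at `a` must land in the support `T` and die on `W`. As `W` lies above `a`, hence
above `a'`, dying there means `W ⊆ W'`. -/
theorem le_of_hom_hook_ne_zero {a' : P} {W' : Set P} (h : IsHook S a W) (hWa : ∀ w ∈ W, a ≤ w)
    (h' : IsHook T a' W') (hne : Module.finrank k (thin k S hS ⟶ thin k T hT) ≠ 0) :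
    (a', W'ᶜ) ≤ (a, Wᶜ) := by
  rw [(hookEquiv h _).finrank_eq, finrank_hookSpace_thin] at hne
  obtain ⟨h1, h2⟩ := of_not_not fun hn => hne (if_neg hn)
  have ha := ((h'.mem_iff a).1 h1).1
  refine ⟨ha, Set.compl_subset_compl.2 fun w hw => ?_⟩
  by_contra hwW
  exact h2 w hw (hWa w hw) ((h'.mem_iff w).2 ⟨ha.trans (hWa w hw), hwW⟩)

end HomDimensions

/-- Going once around the cycle gives the reverse inequality. -/
theorem eq_succ_of_succ_le {Q : Type*} [PartialOrder Q] {n : ℕ} (b : Fin (n + 1) → Q)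
    (h : ∀ i, b (i + 1) ≤ b i) (i : Fin (n + 1)) : b (i + 1) = b i := by
  have key : ∀ (m : ℕ) (j : Fin (n + 1)), b (j + m • 1) ≤ b j := by
    intro m
    induction m with
    | zero => intro j; simp
    | succ m ih =>
      intro j
      rw [succ_nsmul, ← add_assoc]
      exact (h _).trans (ih j)
  refine le_antisymm (h i) ?_
  have h1 := key n (i + 1)
  -- Addition in `Fin (n + 1)` is cyclic: `n` further steps from `i + 1` return to `i`.
  have h2 : i + 1 + n • 1 = i := by
    have h3 := card_nsmul_eq_zero' (x := (1 : Fin (n + 1)))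
    rw [Nat.card_eq_fintype_card, Fintype.card_fin, succ_nsmul] at h3
    rw [add_assoc, add_comm 1, h3, add_zero]
  rwa [h2] at h1

/-! ### The poset with one minimal element: hooks. -/

section VCase

variable {k : Type u} [Field k] {X : Type v} [PartialOrder X] [Finite X]
  {P : Type w} [PartialOrder P] {x₁ x₂ x₃ : X}

theorem IsVShape.exists_iso_hook (hX : IsVShape x₁ x₂ x₃) {U : PMod k X} (hU : Indecomposable U) :
    ∃ (S : Set X) (a : X) (W : Set X) (h : IsHook S a W),
      Nonempty (U ≅ thin k S h.ordConnected) := by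
  rcases hX.classification hU with ⟨a, c, hac, h⟩ | h
  · exact ⟨_, _, _, isHook_Icc hac, h⟩
  · exact ⟨_, _, _, isHook_univ hX.bot_le, h⟩

theorem IsVShape.mem_inducedSet_iff (hX : IsVShape x₁ x₂ x₃) (F : Set (X ↪o P))
    (c : IsoClass (PMod k P)) :
    c ∈ inducedSet k F ↔ ∃ f ∈ F, ∃ (S : Set X) (a : X) (W : Set X) (h : IsHook S a W),
      c = IsoClass.mk (thin k (Set.Ici (f a) \ pushUpper f a W)
        (isHook_pushUpper h).ordConnected) := by
  constructor
  · rintro ⟨f, hf, U, hU, rfl⟩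
    obtain ⟨S, a, W, h, ⟨φ⟩⟩ := hX.exists_iso_hook hU
    exact ⟨f, hf, S, a, W, h, IsoClass.mk_eq_mk_iff.2
      ⟨(induce k f).mapIso φ ≪≫ (nonempty_induce_thin_iso h).some⟩⟩
  · rintro ⟨f, hf, S, a, W, h, rfl⟩
    exact ⟨f, hf, thin k S h.ordConnected, indecomposable_thin_hook h,
      (IsoClass.mk_eq_mk_iff.2 (nonempty_induce_thin_iso h)).symm⟩

omit [Finite X] in
theorem le_of_mem_pushUpper {f : X ↪o P} {a : X} {W : Set X} :
    ∀ w ∈ pushUpper f a W, f a ≤ w :=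
  fun _ ⟨_, _, hax, hxw⟩ => (f.monotone hax).trans hxw

/-- The functionals are `dim Hom(H, -)` for the induced hooks themselves, and the order on positions
makes their matrix unitriangular. -/
theorem IsVShape.isDetected [Finite P] (hX : IsVShape x₁ x₂ x₃) (F : Set (X ↪o P)) :
    IsDetected k F := by
  have : Finite (X ↪o P) := Finite.of_injective (fun f x => f x) DFunLike.coe_injective
  let J := F × {s : Set X × X × Set X // IsHook s.1 s.2.1 s.2.2}
  let H : J → PMod k P := fun j =>
    thin k (Set.Ici (j.1.1 j.2.1.2.1) \ pushUpper j.1.1 j.2.1.2.1 j.2.1.2.2)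
      (isHook_pushUpper j.2.2).ordConnected
  -- The position is the generator together with the complement of the removed upper set. It
  -- determines the support, hence the module, even when different embeddings produce it.
  let t : J → P × Set P := fun j => (j.1.1 j.2.1.2.1, (pushUpper j.1.1 j.2.1.2.1 j.2.1.2.2)ᶜ)
  have hH : ∀ i j, t i = t j → H i = H j := fun i j hij => by
    refine thin_congr ?_
    rw [show j.1.1 j.2.1.2.1 = _ from (congrArg Prod.fst hij).symm,
      ← compl_injective (congrArg Prod.snd hij)]
  have key := unitriangular_criterion t (fun j => SplitK0.cls (IsoClass.mk (H j)))
    (fun j => homFrom (H j)) (fun i j hij => by rw [hH i j hij]) (fun i j hij => by rw [hH i j hij])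
    (fun i j hij => by
      rw [homFrom, SplitK0.lift_cls, Nat.cast_ne_zero] at hij
      exact le_of_hom_hook_ne_zero (isHook_pushUpper i.2.2) le_of_mem_pushUpper
        (isHook_pushUpper j.2.2) hij)
    (fun i => by
      rw [homFrom, SplitK0.lift_cls, finrank_end_thin_hook (isHook_pushUpper i.2.2), Nat.cast_one])
  have hset : SplitK0.cls '' inducedSet k F =
      Set.range fun j => SplitK0.cls (IsoClass.mk (H j)) := by
    ext g
    constructor
    · rintro ⟨c, hc, rfl⟩
      obtain ⟨f, hf, S, a, W, h, rfl⟩ := (hX.mem_inducedSet_iff F c).1 hc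
      exact ⟨⟨⟨f, hf⟩, ⟨(S, a, W), h⟩⟩, rfl⟩
    · rintro ⟨j, rfl⟩
      exact ⟨_, (hX.mem_inducedSet_iff F _).2 ⟨j.1.1, j.1.2, _, _, _, j.2.2, rfl⟩, rfl⟩
  have hhom : ∀ j : J, homFrom (H j) = dimhAt k j.1.1 (thin k _ j.2.2.ordConnected) := fun j => by
    rw [dimhAt_eq_homFrom, homFrom_congr (nonempty_induce_thin_iso j.2.2).some]
  have hvan : ∀ g, DimhVanishes k F g ↔ ∀ j, homFrom (H j) g = 0 := fun g => by
    constructor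
    · intro h j
      rw [hhom]
      exact h _ j.1.2 _ (indecomposable_thin_hook j.2.2)
    · intro h f hf U hU
      obtain ⟨S, a, W, hh, ⟨φ⟩⟩ := hX.exists_iso_hook hU
      rw [dimhAt_congr φ]
      have := h ⟨⟨f, hf⟩, ⟨(S, a, W), hh⟩⟩
      rwa [hhom] at this
  constructor
  · rw [hset]
    exact fun s hs h => key.1 s hs ((hvan s).1 h)
  · rw [hset]
    intro g
    obtain ⟨s, hs, h⟩ := key.2 g
    exact ⟨s, hs, (hvan _).2 h⟩

/-- Positions weakly decrease along nonzero morphisms, so on a cycle they agree. All modules are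
then isomorphic with scalar endomorphisms. -/
theorem IsVShape.hasAcyclicGabrielQuiver [Finite P] (hX : IsVShape x₁ x₂ x₃) (F : Set (X ↪o P)) :
    HasAcyclicGabrielQuiver (inducedSet k F) := by
  intro n Y g hY hg
  simp only [hX.mem_inducedSet_iff] at hY
  choose f _ S a W h hc using hY
  have φ := fun i => (IsoClass.mk_eq_mk_iff.1 (hc i)).some
  let b : Fin (n + 1) → P × Set P := fun i => (f i (a i), (pushUpper (f i) (a i) (W i))ᶜ)
  have hb : ∀ i, b (i + 1) ≤ b i := fun i => by
    refine le_of_hom_hook_ne_zero (k := k) (hS := (isHook_pushUpper (h i)).ordConnected)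
      (hT := (isHook_pushUpper (h (i + 1))).ordConnected) (isHook_pushUpper (h i))
      le_of_mem_pushUpper (isHook_pushUpper (h (i + 1))) ?_
    rw [← finrank_hom_congr_left k (φ i), ← finrank_hom_congr k _ (φ (i + 1))]
    exact (Module.finrank_pos_iff_exists_ne_zero.2 ⟨g i, hg i⟩).ne'
  intro i
  have hi := eq_succ_of_succ_le b hb i
  have hT : thin k _ (isHook_pushUpper (f := f i) (h i)).ordConnected =
      thin k _ (isHook_pushUpper (f := f (i + 1)) (h (i + 1))).ordConnected := by
    refine thin_congr ?_
    rw [show f i (a i) = _ from (congrArg Prod.fst hi).symm,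
      ← compl_injective (congrArg Prod.snd hi)]
  refine isIso_of_finrank_end_eq_one k (φ i ≪≫ eqToIso hT ≪≫ (φ (i + 1)).symm) ?_ (hg i)
  rw [finrank_hom_congr_left k (φ i), finrank_hom_congr k _ (φ i)]
  exact finrank_end_thin_hook (isHook_pushUpper (h i))

end VCase

/-! ### The poset with one maximal element: trading kernels for cokernels. -/

section LambdaCase

variable {k : Type u} [Field k] {X : Type v} [PartialOrder X] {x₁ x₂ x₃ : X}

/-- Rank–nullity, with the annihilator of the range as dual of the cokernel. It turns Hom out of a
module into Hom into a cohook. -/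
theorem finrank_ker_add_finrank {V W : Type*} [AddCommGroup V] [Module k V] [Module.Finite k V]
    [AddCommGroup W] [Module k W] [Module.Finite k W] (α : V →ₗ[k] W) :
    Module.finrank k (LinearMap.ker α) + Module.finrank k W =
      Module.finrank k V + Module.finrank k (LinearMap.range α).dualAnnihilator := by
  have h1 := LinearMap.finrank_range_add_finrank_ker α
  have h2 := Subspace.finrank_add_finrank_dualAnnihilator_eq (LinearMap.range α)
  omega

theorem finrank_hom_hook {P : Type w} [PartialOrder P] {a : P} {S : Set P} {hS : S.OrdConnected}
    (h : IsHook S a ∅) (M : PMod k P) :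
    Module.finrank k (thin k S hS ⟶ M) = Module.finrank k (M.obj a) := by
  have : hookSpace M a ∅ = ⊤ := eq_top_iff.2 fun _ _ _ _ hw => absurd hw (Set.notMem_empty _)
  rw [(hookEquiv h M).finrank_eq, this, finrank_top]

theorem finrank_cohookSpace_empty {P : Type w} [PartialOrder P] (M : PMod k P) (c : P) :
    Module.finrank k (cohookSpace M c ∅) = Module.finrank k (M.obj c) := by
  have : cohookSpace M c ∅ = ⊤ := eq_top_iff.2 fun _ _ _ _ hw => absurd hw (Set.notMem_empty _)
  rw [this, finrank_top]
  exact Subspace.dual_finrank_eq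

theorem IsLambdaShape.ne₁₂ (hX : IsLambdaShape x₁ x₂ x₃) : x₁ ≠ x₂ :=
  fun h => hX.not_le h.le

theorem IsLambdaShape.ne₁₃ (hX : IsLambdaShape x₁ x₂ x₃) : x₁ ≠ x₃ :=
  fun h => hX.not_ge (h ▸ hX.le_top x₂)

theorem IsLambdaShape.ne₂₃ (hX : IsLambdaShape x₁ x₂ x₃) : x₂ ≠ x₃ := hX.symm.ne₁₃

theorem IsLambdaShape.eq_or_eq_top (hX : IsLambdaShape x₁ x₂ x₃) {x y : X} (h : x ≤ y) :
    y = x ∨ y = x₃ := by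
  by_contra! hne
  rcases hX.cover x with rfl | rfl | rfl
  · rcases hX.cover y with rfl | rfl | rfl
    · exact hne.1 rfl
    · exact hX.not_le h
    · exact hne.2 rfl
  · rcases hX.cover y with rfl | rfl | rfl
    · exact hX.not_ge h
    · exact hne.1 rfl
    · exact hne.2 rfl
  · exact hne.2 (le_antisymm (hX.le_top y) h)

/-- Hom from the simple module at `i` is the kernel of the map from `i` to the top, and the cohook
space is the dual of its cokernel. -/
theorem IsLambdaShape.finrank_hom_simple (hX : IsLambdaShape x₁ x₂ x₃) (N : PMod k X) {i : X}
    (hi : i ≠ x₃) :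
    Module.finrank k (thin k (Set.Icc i i) Set.ordConnected_Icc ⟶ N) +
      Module.finrank k (N.obj x₃) =
    Module.finrank k (N.obj i) + Module.finrank k (cohookSpace N x₃ {i}) := by
  have h1 : hookSpace N i {q | ¬ q ≤ i} = LinearMap.ker (transition N (hX.le_top i)) := by
    ext m
    constructor
    · exact fun h => h x₃ (hX.le_top i) fun h => hi (le_antisymm (hX.le_top i) h)
    · intro h w hw hw'
      rcases hX.eq_or_eq_top hw with rfl | rfl
      · exact absurd le_rfl hw'
      · exact h
  have h2 : cohookSpace N x₃ {i} =
      (LinearMap.range (transition N (hX.le_top i))).dualAnnihilator := by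
    ext ψ
    rw [Submodule.mem_dualAnnihilator]
    constructor
    · rintro h _ ⟨m, rfl⟩
      exact h i _ rfl m
    · rintro h p hp rfl m
      exact h _ ⟨m, rfl⟩
  rw [(hookEquiv (isHook_Icc le_rfl) N).finrank_eq, h1, h2]
  exact finrank_ker_add_finrank _

/-- Hom from the constant module is the pullback of the two legs, that is, the kernel of `(α, -β)`;
the cohook space is the dual of the cokernel of the same map. -/
theorem IsLambdaShape.finrank_hom_univ (hX : IsLambdaShape x₁ x₂ x₃) (N : PMod k X) :
    Module.finrank k (thin k Set.univ Set.ordConnected_univ ⟶ N) + Module.finrank k (N.obj x₃) =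
    Module.finrank k (N.obj x₁) + Module.finrank k (N.obj x₂) +
      Module.finrank k (cohookSpace N x₃ {x₁, x₂}) := by
  classical
  let α := transition N (hX.le_top x₁)
  let β := transition N (hX.le_top x₂)
  let vec : ∀ p, (thin k (Set.univ : Set X) Set.ordConnected_univ).obj p :=
    fun p => thinVec p (Set.mem_univ p) 1
  let L : (thin k Set.univ Set.ordConnected_univ ⟶ N) →ₗ[k] N.obj x₁ × N.obj x₂ :=
    { toFun φ := (component x₁ φ (vec x₁), component x₂ φ (vec x₂))
      map_add' _ _ := rfl
      map_smul' _ _ := rfl }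
  have hvec : ∀ (p q : X) (h : p ≤ q), transition _ h (vec p) = vec q := fun p q h =>
    thinCoord_injective q (by rw [thinCoord_transition, if_pos (Set.mem_univ q)]; rfl)
  have hext : ∀ φ : thin k Set.univ Set.ordConnected_univ ⟶ N,
      (∀ p, component p φ (vec p) = 0) → φ = 0 := by
    intro φ h
    refine hom_ext_component fun p m => ?_
    have hm : m = thinCoord p m • vec p :=
      thinCoord_injective p (by rw [map_smul, smul_eq_mul]; exact (mul_one _).symm)
    rw [hm, map_smul, h, smul_zero]
    exact (map_zero (component p (0 : thin k Set.univ Set.ordConnected_univ ⟶ N))).symm.trans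
      (by rw [map_zero]; rfl)
  have hinj : Function.Injective L := by
    rw [injective_iff_map_eq_zero]
    intro φ hφ
    have h1 : component x₁ φ (vec x₁) = 0 := congrArg Prod.fst hφ
    refine hext φ fun p => ?_
    rcases hX.cover p with rfl | rfl | rfl
    · exact h1
    · exact congrArg Prod.snd hφ
    · rw [← hvec x₁ p (hX.le_top _), component_transition, h1, map_zero]
  have hrange : LinearMap.range L = LinearMap.ker (α.coprod (-β)) := by
    ext ⟨y, z⟩
    rw [LinearMap.mem_ker, LinearMap.coprod_apply, LinearMap.neg_apply, add_neg_eq_zero]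
    constructor
    · rintro ⟨φ, hφ⟩
      have h1 : component x₁ φ (vec x₁) = y := congrArg Prod.fst hφ
      have h2 : component x₂ φ (vec x₂) = z := congrArg Prod.snd hφ
      rw [← h1, ← h2]
      change transition N _ _ = transition N _ _
      rw [← component_transition, ← component_transition, hvec, hvec]
    · intro h
      let m : ∀ p, N.obj p :=
        Function.update (Function.update (Function.update 0 x₁ y) x₂ z) x₃ (α y)
      have m1 : m x₁ = y := by simp [m, hX.ne₁₂, hX.ne₁₃]
      have m2 : m x₂ = z := by simp [m, hX.ne₂₃]
      have m3 : m x₃ = α y := by simp [m]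
      have hm : ∀ p, transition N (hX.le_top p) (m p) = m x₃ := fun p => by
        rcases hX.cover p with rfl | rfl | rfl
        · rw [m3, m1]
        · rw [m3, m2]; exact h.symm
        · exact eq_of_transition_refl _ _ _
      refine ⟨thinDesc m (fun p hp => absurd trivial hp) (fun p q hpq _ => ?_) _, ?_⟩
      · rcases hX.eq_or_eq_top hpq with rfl | rfl
        · exact eq_of_transition_refl _ _ _
        · exact hm p
      · refine Prod.ext ?_ ?_
        · exact (component_thinDesc _ _).trans ((one_smul _ _).trans m1)
        · exact (component_thinDesc _ _).trans ((one_smul _ _).trans m2)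
  have h2 : cohookSpace N x₃ {x₁, x₂} =
      (LinearMap.range (α.coprod (-β))).dualAnnihilator := by
    ext ψ
    rw [Submodule.mem_dualAnnihilator]
    constructor
    · rintro h _ ⟨⟨y, z⟩, rfl⟩
      have e1 : ψ (α y) = 0 := h x₁ _ (Or.inl rfl) y
      have e2 : ψ (β z) = 0 := h x₂ _ (Or.inr rfl) z
      rw [LinearMap.coprod_apply, LinearMap.neg_apply, map_add, map_neg, e1, e2, neg_zero, add_zero]
    · rintro h p hp (rfl | rfl) m
      · exact h _ ⟨(m, 0), by simp [α]⟩
      · exact h _ ⟨(0, -m), by simp [β]⟩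
  rw [← LinearMap.finrank_range_of_inj hinj, hrange, h2, finrank_ker_add_finrank,
    Module.finrank_prod]

end LambdaCase

/-! ### Positions, cohook functionals and virtual modules. -/

section LambdaDetection

variable {k : Type u} [Field k] {X : Type v} [PartialOrder X]
  {P : Type w} [PartialOrder P] {x₁ x₂ x₃ : X}

variable (k) in
/-- The thin module supported on the principal lower set of `p` without the lower set `D`. -/
noncomputable def lowerThin (q : LowerSet P × P) : PMod k P :=
  thin k (Set.Iic q.2 \ q.1) ⟨fun _ hx _ hy _ hz =>
    ⟨hz.2.trans hy.1, fun h => hx.2 (q.1.lower hz.1 h)⟩⟩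

theorem isCohook_lowerThin {q : LowerSet P × P} (h : q.2 ∉ q.1) :
    IsCohook (Set.Iic q.2 \ q.1) q.2 (q.1 : Set P) :=
  ⟨q.1.lower, h, fun _ => Iff.rfl⟩

variable (k) in
/-- The class of the projective module at a point. -/
noncomputable def projClass (p : P) : SplitK0 (PMod k P) :=
  SplitK0.cls (IsoClass.mk (thin k (Set.Ici p) Set.ordConnected_Ici))

theorem isHook_Ici (p : P) : IsHook (Set.Ici p) p ∅ :=
  ⟨fun _ _ _ h => h, id, fun q => by simp⟩

/-- The functional `M ↦ dim M_p`. -/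
noncomputable def dimAt [Finite P] (p : P) : SplitK0 (PMod k P) →+ ℤ :=
  homFrom (thin k (Set.Ici p) Set.ordConnected_Ici)

theorem dimAt_cls [Finite P] (p : P) (M : PMod k P) :
    dimAt p (SplitK0.cls (IsoClass.mk M)) = Module.finrank k (M.obj p) := by
  rw [dimAt, homFrom, SplitK0.lift_cls, finrank_hom_hook (isHook_Ici p)]

theorem homTo_projClass [Finite P] (T : PMod k P) (p : P) :
    homTo T (projClass k p) = Module.finrank k (T.obj p) := by
  rw [projClass, homTo, SplitK0.lift_cls, finrank_hom_hook (isHook_Ici p)]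

theorem homTo_induce [Finite X] [Finite P] (f : X ↪o P) (T : PMod k P) (U : PMod k X) :
    homTo T (SplitK0.cls (IsoClass.mk ((induce k f).obj U))) =
      Module.finrank k (U ⟶ (restrict k f).obj T) := by
  rw [homTo, SplitK0.lift_cls, (induceHomEquiv f U T).finrank_eq]

theorem dimhAt_cls [Finite X] [Finite P] (f : X ↪o P) (U : PMod k X) (M : PMod k P) :
    dimhAt k f U (SplitK0.cls (IsoClass.mk M)) =
      Module.finrank k (U ⟶ (restrict k f).obj M) := by
  rw [dimhAt, SplitK0.lift_cls]

theorem IsLambdaShape.isHook_Icc_top (hX : IsLambdaShape x₁ x₂ x₃) (c : X) :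
    IsHook (Set.Icc c x₃) c ∅ :=
  ⟨fun _ _ _ h => h, id, fun q => by simp [hX.le_top]⟩

theorem dimhAt_Icc_top [Finite X] [Finite P] (hX : IsLambdaShape x₁ x₂ x₃) (f : X ↪o P) (c : X) :
    dimhAt k f (thin k (Set.Icc c x₃) Set.ordConnected_Icc) = dimAt (f c) :=
  SplitK0.hom_ext fun M => by
    rw [dimhAt_cls, dimAt_cls, finrank_hom_hook (hX.isHook_Icc_top c)]
    rfl

theorem cls_induce_Icc_top [Finite X] (hX : IsLambdaShape x₁ x₂ x₃) (f : X ↪o P) (c : X) :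
    SplitK0.cls (IsoClass.mk ((induce k f).obj (thin k (Set.Icc c x₃) Set.ordConnected_Icc))) =
      projClass k (f c) := by
  rw [SplitK0.cls_mk_eq_of_iso (nonempty_induce_thin_iso (hX.isHook_Icc_top c)).some, projClass]
  rw [thin_congr (T := Set.Ici (f c)) (hT := Set.ordConnected_Ici)]
  ext p
  simp [pushUpper]

/-- The positions of the modules in the basis attached to an embedding: projective modules,
modules induced from simple non-projective modules, and the module induced from the constant
module. -/
abbrev LambdaKind (x₃ : X) : Type v := Option (X ⊕ {i : X // i ≠ x₃})

/-- The lower set and the point attached to a position. -/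
def lambdaIndex (x₁ x₂ x₃ : X) (f : X ↪o P) : LambdaKind x₃ → LowerSet P × P
  | some (Sum.inl c) => (⊥, f c)
  | some (Sum.inr i) => (LowerSet.Iic (f i), f x₃)
  | none => (LowerSet.Iic (f x₁) ⊔ LowerSet.Iic (f x₂), f x₃)

theorem lambdaIndex_le (hX : IsLambdaShape x₁ x₂ x₃) (f : X ↪o P) (s : LambdaKind x₃) :
    ∀ p ∈ (lambdaIndex x₁ x₂ x₃ f s).1, p ≤ (lambdaIndex x₁ x₂ x₃ f s).2 := by
  have hle : ∀ i : X, ∀ p, p ≤ f i → p ≤ f x₃ := fun i p h => h.trans (f.monotone (hX.le_top i))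
  rcases s with _ | c | i
  · rintro p (h | h)
    exacts [hle _ p h, hle _ p h]
  · rintro p ⟨⟩
  · exact hle i

variable (k) in
/-- The virtual module attached to a position. -/
noncomputable def lambdaClass [Finite X] (x₁ x₂ x₃ : X) (f : X ↪o P) : LambdaKind x₃ → SplitK0 (PMod k P)
  | some (Sum.inl c) => projClass k (f c)
  -- The projective corrections are those of the kernel–cokernel identities: pairing with `homTo T`
  -- then gives the dimension of a cohook space of `T`.
  | some (Sum.inr i) => SplitK0.cls (IsoClass.mk ((induce k f).obj
      (thin k (Set.Icc i.1 i.1) Set.ordConnected_Icc))) + projClass k (f x₃) - projClass k (f i)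
  | none => SplitK0.cls (IsoClass.mk ((induce k f).obj
      (thin k Set.univ Set.ordConnected_univ))) +
      projClass k (f x₃) - projClass k (f x₁) - projClass k (f x₂)

theorem pushLower_singleton (hX : IsLambdaShape x₁ x₂ x₃) (f : X ↪o P) (i : X) :
    pushLower f x₃ {i} = (LowerSet.Iic (f i) : Set P) := by
  ext p
  simp [pushLower, hX.le_top]

theorem pushLower_pair (hX : IsLambdaShape x₁ x₂ x₃) (f : X ↪o P) :
    pushLower f x₃ {x₁, x₂} = (LowerSet.Iic (f x₁) ⊔ LowerSet.Iic (f x₂) : LowerSet P) := by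
  ext p
  simp [pushLower, hX.le_top]

theorem lambdaIndex_notMem (hX : IsLambdaShape x₁ x₂ x₃) (f : X ↪o P) (s : LambdaKind x₃) :
    (lambdaIndex x₁ x₂ x₃ f s).2 ∉ (lambdaIndex x₁ x₂ x₃ f s).1 := by
  have hle : ∀ i : X, i ≠ x₃ → ¬ f x₃ ≤ f i := fun i hi h =>
    hi (le_antisymm (hX.le_top i) (f.le_iff_le.1 h))
  rcases s with _ | c | i
  · simp [lambdaIndex, -OrderEmbedding.le_iff_le, hle _ hX.ne₁₃, hle _ hX.ne₂₃]
  · simp [lambdaIndex]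
  · simp [lambdaIndex, -OrderEmbedding.le_iff_le, hle _ i.2]

theorem finrank_hom_restrict_simple (hX : IsLambdaShape x₁ x₂ x₃) (f : X ↪o P)
    (i : {i : X // i ≠ x₃}) (M : PMod k P) :
    Module.finrank k (thin k (Set.Icc i.1 i.1) Set.ordConnected_Icc ⟶ (restrict k f).obj M) +
      Module.finrank k (M.obj (f x₃)) = Module.finrank k (M.obj (f i)) +
      Module.finrank k (cohookSpace M (lambdaIndex x₁ x₂ x₃ f (some (Sum.inr i))).2
        (lambdaIndex x₁ x₂ x₃ f (some (Sum.inr i))).1) := by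
  have := hX.finrank_hom_simple ((restrict k f).obj M) i.2
  rw [cohookSpace_restrict, pushLower_singleton hX] at this
  exact this

theorem finrank_hom_restrict_univ (hX : IsLambdaShape x₁ x₂ x₃) (f : X ↪o P) (M : PMod k P) :
    Module.finrank k (thin k Set.univ Set.ordConnected_univ ⟶ (restrict k f).obj M) +
      Module.finrank k (M.obj (f x₃)) = Module.finrank k (M.obj (f x₁)) +
      Module.finrank k (M.obj (f x₂)) +
      Module.finrank k (cohookSpace M (lambdaIndex x₁ x₂ x₃ f none).2
        (lambdaIndex x₁ x₂ x₃ f none).1) := by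
  have := hX.finrank_hom_univ ((restrict k f).obj M)
  rw [cohookSpace_restrict, pushLower_pair hX] at this
  exact this

theorem finrank_cohookSpace_lambdaIndex_proj (f : X ↪o P) (c : X) (M : PMod k P) :
    Module.finrank k (cohookSpace M (lambdaIndex x₁ x₂ x₃ f (some (Sum.inl c))).2
      (lambdaIndex x₁ x₂ x₃ f (some (Sum.inl c))).1) = Module.finrank k (M.obj (f c)) :=
  have h : ((⊥ : LowerSet P) : Set P) = ∅ := LowerSet.coe_bot
  (congrArg (fun D => Module.finrank k (cohookSpace M (f c) D)) h).trans
    (finrank_cohookSpace_empty M (f c))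

theorem homTo_lowerThin_cls [Finite P] {q : LowerSet P × P} (h : q.2 ∉ q.1) (M : PMod k P) :
    homTo (lowerThin k q) (SplitK0.cls (IsoClass.mk M)) =
      Module.finrank k (cohookSpace M q.2 q.1) := by
  rw [homTo, SplitK0.lift_cls]
  exact congrArg Nat.cast (cohookEquiv (isCohook_lowerThin h) M).finrank_eq

theorem homTo_lambda_proj [Finite P] (hX : IsLambdaShape x₁ x₂ x₃) (f : X ↪o P) (c : X) :
    homTo (lowerThin k (lambdaIndex x₁ x₂ x₃ f (some (Sum.inl c)))) = dimAt (f c) :=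
  SplitK0.hom_ext fun M => by
    rw [dimAt_cls, homTo_lowerThin_cls (lambdaIndex_notMem hX f _),
      finrank_cohookSpace_lambdaIndex_proj]

/-- The two functionals differ by dimensions at `f i` and `f x₃`, which are themselves coordinates
of `dimh` since they are Hom from projective modules. -/
theorem homTo_lambda_simple [Finite X] [Finite P] (hX : IsLambdaShape x₁ x₂ x₃) (f : X ↪o P)
    (i : {i : X // i ≠ x₃}) :
    homTo (lowerThin k (lambdaIndex x₁ x₂ x₃ f (some (Sum.inr i)))) + dimAt (f i) =
      dimhAt k f (thin k (Set.Icc i.1 i.1) Set.ordConnected_Icc) + dimAt (f x₃) :=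
  SplitK0.hom_ext fun M => by
    rw [AddMonoidHom.add_apply, AddMonoidHom.add_apply, dimAt_cls, dimAt_cls, dimhAt_cls,
      homTo_lowerThin_cls (lambdaIndex_notMem hX f _)]
    have := finrank_hom_restrict_simple hX f i M
    omega

theorem homTo_lambda_univ [Finite X] [Finite P] (hX : IsLambdaShape x₁ x₂ x₃) (f : X ↪o P) :
    homTo (lowerThin k (lambdaIndex x₁ x₂ x₃ f none)) + dimAt (f x₁) + dimAt (f x₂) =
      dimhAt k f (thin k Set.univ Set.ordConnected_univ) + dimAt (f x₃) :=
  SplitK0.hom_ext fun M => by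
    simp only [AddMonoidHom.add_apply]
    rw [dimAt_cls, dimAt_cls, dimAt_cls, dimhAt_cls,
      homTo_lowerThin_cls (lambdaIndex_notMem hX f _)]
    have := finrank_hom_restrict_univ hX f M
    omega

open Classical in
/-- The value of the functional at one position on the virtual module at another position. -/
theorem homTo_lambdaClass [Finite X] [Finite P] (hX : IsLambdaShape x₁ x₂ x₃) (q : LowerSet P × P)
    (f : X ↪o P) (s : LambdaKind x₃) :
    homTo (lowerThin k q) (lambdaClass k x₁ x₂ x₃ f s) =
      if (lambdaIndex x₁ x₂ x₃ f s).2 ∈ Set.Iic q.2 \ (q.1 : Set P) ∧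
        ∀ p ∈ (lambdaIndex x₁ x₂ x₃ f s).1, p ≤ (lambdaIndex x₁ x₂ x₃ f s).2 →
          p ∉ Set.Iic q.2 \ (q.1 : Set P) then 1 else 0 := by
  -- The kernel–cokernel identities are now applied to the target `lowerThin k q` itself, with
  -- Frobenius reciprocity on the induced summand.
  have key : Module.finrank k (cohookSpace (lowerThin k q) (lambdaIndex x₁ x₂ x₃ f s).2
      (lambdaIndex x₁ x₂ x₃ f s).1) = homTo (lowerThin k q) (lambdaClass k x₁ x₂ x₃ f s) := by
    rcases s with _ | c | i
    · have := finrank_hom_restrict_univ hX f (lowerThin k q)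
      simp only [lambdaClass, map_add, map_sub, homTo_projClass, homTo_induce]
      omega
    · rw [finrank_cohookSpace_lambdaIndex_proj]
      exact (homTo_projClass _ _).symm
    · have := finrank_hom_restrict_simple hX f i (lowerThin k q)
      simp only [lambdaClass, map_add, map_sub, homTo_projClass, homTo_induce]
      omega
  rw [← key, lowerThin, finrank_cohookSpace_thin]
  push_cast
  rfl

end LambdaDetection

/-! ### Detection for the poset with one maximal element. -/

section LambdaDetection

variable {k : Type u} [Field k] {X : Type v} [PartialOrder X] [Finite X]
  {P : Type w} [PartialOrder P] {x₁ x₂ x₃ : X}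

omit [Finite X] in
theorem IsLambdaShape.exists_swap (hX : IsLambdaShape x₁ x₂ x₃) :
    ∃ σ : X ≃o X, σ x₁ = x₂ ∧ σ x₂ = x₁ ∧ σ x₃ = x₃ := by
  classical
  have h1 : Equiv.swap x₁ x₂ x₁ = x₂ := Equiv.swap_apply_left _ _
  have h2 : Equiv.swap x₁ x₂ x₂ = x₁ := Equiv.swap_apply_right _ _
  have h3 : Equiv.swap x₁ x₂ x₃ = x₃ :=
    Equiv.swap_apply_of_ne_of_ne hX.ne₁₃.symm hX.ne₂₃.symm
  have hmono : ∀ a b, a ≤ b → Equiv.swap x₁ x₂ a ≤ Equiv.swap x₁ x₂ b := fun a b hab => by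
    rcases hX.eq_or_eq_top hab with rfl | rfl
    · exact le_rfl
    · rw [h3]; exact hX.le_top _
  refine ⟨⟨Equiv.swap x₁ x₂, fun {a b} => ⟨fun h => ?_, hmono a b⟩⟩, h1, h2, h3⟩
  simpa using hmono _ _ h

/-- An antichain is recovered as the set of maximal elements of the lower set it generates. -/
theorem eq_or_eq_swap_of_Iic_sup_Iic_eq {a b a' b' : P} (hab : ¬ a ≤ b) (hba : ¬ b ≤ a)
    (hab' : ¬ a' ≤ b') (hba' : ¬ b' ≤ a')
    (h : LowerSet.Iic a ⊔ LowerSet.Iic b = LowerSet.Iic a' ⊔ LowerSet.Iic b') :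
    a = a' ∧ b = b' ∨ a = b' ∧ b = a' := by
  have h0 : ∀ p, p ≤ a ∨ p ≤ b ↔ p ≤ a' ∨ p ≤ b' := fun p => by
    have := SetLike.ext_iff.1 h p
    simpa using this
  have ha := (h0 a).1 (Or.inl le_rfl)
  have hb := (h0 b).1 (Or.inr le_rfl)
  have ha' := (h0 a').2 (Or.inl le_rfl)
  have hb' := (h0 b').2 (Or.inr le_rfl)
  rcases ha with ha | ha
  · have h1 : a' ≤ a := ha'.resolve_right fun h => hab (ha.trans h)
    have h2 : b ≤ b' := hb.resolve_left fun h => hba (h.trans h1)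
    have h3 : b' ≤ b := hb'.resolve_left fun h => hba' (h.trans ha)
    exact Or.inl ⟨le_antisymm ha h1, le_antisymm h2 h3⟩
  · have h1 : b' ≤ a := hb'.resolve_right fun h => hab (ha.trans h)
    have h2 : b ≤ a' := hb.resolve_right fun h => hba (h.trans h1)
    have h3 : a' ≤ b := ha'.resolve_left fun h => hab' (h.trans ha)
    exact Or.inr ⟨le_antisymm ha h1, le_antisymm h2 h3⟩

theorem Iic_ne_Iic_sup_Iic {a b c : P} (hab : ¬ a ≤ b) (hba : ¬ b ≤ a) :
    LowerSet.Iic c ≠ LowerSet.Iic a ⊔ LowerSet.Iic b := by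
  intro h
  have h0 : ∀ p, p ≤ c ↔ p ≤ a ∨ p ≤ b := fun p => by
    have := SetLike.ext_iff.1 h p
    simpa using this
  have ha := (h0 a).2 (Or.inl le_rfl)
  have hb := (h0 b).2 (Or.inr le_rfl)
  rcases (h0 c).1 le_rfl with h | h
  · exact hba (hb.trans h)
  · exact hab (ha.trans h)

omit [Finite X] in
theorem Ici_diff_pushUpper_Icc_self (hX : IsLambdaShape x₁ x₂ x₃) (f : X ↪o P) (i : {i : X // i ≠ x₃}) :
    Set.Ici (f i.1) \ pushUpper f i.1 {q | ¬ q ≤ i.1} = Set.Ici (f i.1) \ Set.Ici (f x₃) := by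
  congr 1
  ext p
  constructor
  · rintro ⟨w, hw, hiw, hwp⟩
    rcases hX.eq_or_eq_top hiw with rfl | rfl
    · exact absurd le_rfl hw
    · exact hwp
  · exact fun h => ⟨x₃, fun h => i.2 (le_antisymm (hX.le_top _) h), hX.le_top _, h⟩

/-- The support is `Set.Ici (f i) \ Set.Ici (f x₃)`, so the other minimal point does not matter. -/
theorem cls_induce_simple_congr (hX : IsLambdaShape x₁ x₂ x₃) {f g : X ↪o P}
    {i j : {i : X // i ≠ x₃}} (hij : f i = g j) (h3 : f x₃ = g x₃) :
    SplitK0.cls (IsoClass.mk ((induce k f).obj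
      (thin k (Set.Icc i.1 i.1) Set.ordConnected_Icc))) =
    SplitK0.cls (IsoClass.mk ((induce k g).obj
      (thin k (Set.Icc j.1 j.1) Set.ordConnected_Icc))) := by
  rw [SplitK0.cls_mk_eq_of_iso (nonempty_induce_thin_iso (isHook_Icc le_rfl)).some,
    SplitK0.cls_mk_eq_of_iso (nonempty_induce_thin_iso (isHook_Icc le_rfl)).some]
  rw [thin_congr]
  rw [Ici_diff_pushUpper_Icc_self hX, Ici_diff_pushUpper_Icc_self hX, hij, h3]

/-- The shape of the lower set (empty, principal, or generated by two incomparable points) tells the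
kinds apart. In the last case the position fixes the embedding up to the swap of the minimal points,
and `hF` makes it unique. -/
theorem lambdaClass_congr (hX : IsLambdaShape x₁ x₂ x₃) {F : Set (X ↪o P)}
    (hF : ∀ f ∈ F, ∀ g ∈ F, (∃ σ : X ≃o X, ∀ x, g x = f (σ x)) → f = g) {f g : X ↪o P}
    (hf : f ∈ F) (hg : g ∈ F) {s t : LambdaKind x₃}
    (h : lambdaIndex x₁ x₂ x₃ f s = lambdaIndex x₁ x₂ x₃ g t) :
    lambdaClass k x₁ x₂ x₃ f s = lambdaClass k x₁ x₂ x₃ g t := by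
  have hanti : ∀ f : X ↪o P, ¬ f x₁ ≤ f x₂ ∧ ¬ f x₂ ≤ f x₁ := fun f =>
    ⟨fun h => hX.not_le (f.le_iff_le.1 h), fun h => hX.not_ge (f.le_iff_le.1 h)⟩
  have hbot : ∀ p : P, LowerSet.Iic p ≠ ⊥ := fun p h => by
    have : p ∈ LowerSet.Iic p := le_rfl
    rw [h] at this
    exact this
  have hbot' : ∀ p q : P, LowerSet.Iic p ⊔ LowerSet.Iic q ≠ ⊥ := fun p q h =>
    hbot p (le_bot_iff.1 (h ▸ le_sup_left))
  obtain ⟨h1, h2⟩ := Prod.ext_iff.1 h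
  rcases s with _ | c | i <;> rcases t with _ | d | j <;>
    simp only [lambdaIndex] at h1 h2
  · have : f = g := by
      refine hF f hf g hg ?_
      rcases eq_or_eq_swap_of_Iic_sup_Iic_eq (hanti f).1 (hanti f).2 (hanti g).1 (hanti g).2 h1
        with ⟨h3, h4⟩ | ⟨h3, h4⟩
      · refine ⟨OrderIso.refl X, fun x => ?_⟩
        rcases hX.cover x with rfl | rfl | rfl
        exacts [h3.symm, h4.symm, h2.symm]
      · obtain ⟨σ, s1, s2, s3⟩ := hX.exists_swap
        refine ⟨σ, fun x => ?_⟩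
        rcases hX.cover x with rfl | rfl | rfl
        · rw [s1, h4]
        · rw [s2, h3]
        · rw [s3, h2]
    rw [this]
  · exact absurd h1 (hbot' _ _)
  · exact absurd h1.symm (Iic_ne_Iic_sup_Iic (hanti f).1 (hanti f).2)
  · exact absurd h1.symm (hbot' _ _)
  · simp only [lambdaClass, h2]
  · exact absurd h1.symm (hbot _)
  · exact absurd h1 (Iic_ne_Iic_sup_Iic (hanti g).1 (hanti g).2)
  · exact absurd h1 (hbot _)
  · have h3 : f i = g j := LowerSet.Iic_injective h1
    simp only [lambdaClass, h2, h3, cls_induce_simple_congr hX h3 h2]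

theorem IsLambdaShape.exists_iso (hX : IsLambdaShape x₁ x₂ x₃) {U : PMod k X}
    (hU : Indecomposable U) :
    (∃ c, Nonempty (U ≅ thin k (Set.Icc c x₃) Set.ordConnected_Icc)) ∨
      (∃ i : {i : X // i ≠ x₃}, Nonempty (U ≅ thin k (Set.Icc i.1 i.1) Set.ordConnected_Icc)) ∨
      Nonempty (U ≅ thin k Set.univ Set.ordConnected_univ) := by
  rcases hX.classification hU with ⟨a, c, hac, h⟩ | h
  · by_cases hc : c = x₃
    · subst hc
      exact Or.inl ⟨a, h⟩
    · obtain rfl : c = a := (hX.eq_or_eq_top hac).resolve_right hc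
      exact Or.inr (Or.inl ⟨⟨c, hc⟩, h⟩)
  · exact Or.inr (Or.inr h)

theorem IsLambdaShape.indecomposable_univ (hX : IsLambdaShape x₁ x₂ x₃) :
    Indecomposable (thin k (Set.univ : Set X) Set.ordConnected_univ) :=
  indecomposable_of_finrank_end_eq_one k (finrank_end_thin_cohook (isCohook_univ hX.le_top))

/-- Virtual modules and induced classes differ by projective classes, which belong to both families.
-/
theorem IsLambdaShape.closure_inducedSet (hX : IsLambdaShape x₁ x₂ x₃) (F : Set (X ↪o P)) :
    AddSubgroup.closure (SplitK0.cls '' inducedSet k F) =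
      AddSubgroup.closure (Set.range fun j : F × LambdaKind x₃ =>
        lambdaClass k x₁ x₂ x₃ j.1.1 j.2) := by
  have hmem : ∀ f ∈ F, ∀ U : PMod k X, Indecomposable U →
      SplitK0.cls (IsoClass.mk ((induce k f).obj U)) ∈
        AddSubgroup.closure (SplitK0.cls '' inducedSet k F) := fun f hf U hU =>
    AddSubgroup.subset_closure ⟨_, ⟨f, hf, U, hU, rfl⟩, rfl⟩
  have hproj : ∀ f ∈ F, ∀ c, projClass k (f c) ∈
      AddSubgroup.closure (SplitK0.cls '' inducedSet k F) := fun f hf c => by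
    rw [← cls_induce_Icc_top hX]
    exact hmem f hf _ (indecomposable_thin_hook (hX.isHook_Icc_top c))
  refine le_antisymm ((AddSubgroup.closure_le _).2 ?_) ((AddSubgroup.closure_le _).2 ?_)
  · rintro _ ⟨_, ⟨f, hf, U, hU, rfl⟩, rfl⟩
    have hc : ∀ s, lambdaClass k x₁ x₂ x₃ f s ∈ AddSubgroup.closure
        (Set.range fun j : F × LambdaKind x₃ => lambdaClass k x₁ x₂ x₃ j.1.1 j.2) := fun s =>
      AddSubgroup.subset_closure ⟨(⟨f, hf⟩, s), rfl⟩
    have hp : ∀ c, projClass k (f c) ∈ AddSubgroup.closure (Set.range fun j : F × LambdaKind x₃ =>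
        lambdaClass k x₁ x₂ x₃ j.1.1 j.2) := fun c => hc (some (Sum.inl c))
    rcases hX.exists_iso hU with ⟨c, ⟨φ⟩⟩ | ⟨i, ⟨φ⟩⟩ | ⟨⟨φ⟩⟩
    · rw [SplitK0.cls_mk_eq_of_iso ((induce k f).mapIso φ), cls_induce_Icc_top hX]
      exact hp c
    · rw [SplitK0.cls_mk_eq_of_iso ((induce k f).mapIso φ)]
      have h : SplitK0.cls (IsoClass.mk ((induce k f).obj
          (thin k (Set.Icc i.1 i.1) Set.ordConnected_Icc))) =
          lambdaClass k x₁ x₂ x₃ f (some (Sum.inr i)) - projClass k (f x₃) + projClass k (f i) := by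
        simp only [lambdaClass]
        abel
      rw [h]
      exact add_mem (sub_mem (hc _) (hp x₃)) (hp i)
    · rw [SplitK0.cls_mk_eq_of_iso ((induce k f).mapIso φ)]
      have h : SplitK0.cls (IsoClass.mk ((induce k f).obj
          (thin k Set.univ Set.ordConnected_univ))) =
          lambdaClass k x₁ x₂ x₃ f none - projClass k (f x₃) + projClass k (f x₁) +
            projClass k (f x₂) := by
        simp only [lambdaClass]
        abel
      rw [h]
      exact add_mem (add_mem (sub_mem (hc _) (hp x₃)) (hp x₁)) (hp x₂)
  · rintro _ ⟨⟨⟨f, hf⟩, s⟩, rfl⟩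
    rcases s with _ | c | i
    · exact sub_mem (sub_mem (add_mem (hmem f hf _ hX.indecomposable_univ) (hproj f hf _))
        (hproj f hf _)) (hproj f hf _)
    · exact hproj f hf c
    · exact sub_mem (add_mem (hmem f hf _ (indecomposable_thin_hook (isHook_Icc le_rfl)))
        (hproj f hf _)) (hproj f hf _)

/-- Both families contain the dimensions at the points of the images. Once these vanish, the
remaining functionals agree in pairs. -/
theorem IsLambdaShape.dimhVanishes_iff [Finite P] (hX : IsLambdaShape x₁ x₂ x₃)
    (F : Set (X ↪o P)) (g : SplitK0 (PMod k P)) :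
    DimhVanishes k F g ↔ ∀ j : F × LambdaKind x₃,
      homTo (lowerThin k (lambdaIndex x₁ x₂ x₃ j.1.1 j.2)) g = 0 := by
  have hs := fun (f : X ↪o P) (i : {i : X // i ≠ x₃}) =>
    DFunLike.congr_fun (homTo_lambda_simple (k := k) hX f i) g
  have hu := fun f : X ↪o P => DFunLike.congr_fun (homTo_lambda_univ (k := k) hX f) g
  simp only [AddMonoidHom.add_apply] at hs hu
  constructor
  · rintro h ⟨⟨f, hf⟩, s⟩
    have hp : ∀ c, dimAt (f c) g = 0 := fun c => by
      rw [← dimhAt_Icc_top hX]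
      exact h f hf _ (indecomposable_thin_hook (hX.isHook_Icc_top c))
    rcases s with _ | c | i
    · have := hu f
      rwa [h f hf _ hX.indecomposable_univ, hp, hp, hp, add_zero, add_zero, add_zero] at this
    · rw [homTo_lambda_proj hX]
      exact hp c
    · have := hs f i
      rwa [h f hf _ (indecomposable_thin_hook (isHook_Icc le_rfl)), hp, hp, add_zero,
        add_zero] at this
  · intro h f hf U hU
    have h' := fun s => h (⟨f, hf⟩, s)
    have hp : ∀ c, dimAt (f c) g = 0 := fun c => by
      rw [← homTo_lambda_proj hX]
      exact h' _
    rcases hX.exists_iso hU with ⟨c, ⟨φ⟩⟩ | ⟨i, ⟨φ⟩⟩ | ⟨⟨φ⟩⟩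
    · rw [dimhAt_congr φ, dimhAt_Icc_top hX]
      exact hp c
    · rw [dimhAt_congr φ]
      have := hs f i
      rw [h' (some (Sum.inr i)), hp, hp, add_zero, add_zero] at this
      exact this.symm
    · rw [dimhAt_congr φ]
      have := hu f
      rw [h' none, hp, hp, hp, add_zero, add_zero, add_zero] at this
      exact this.symm

theorem IsLambdaShape.isDetected [Finite P] (hX : IsLambdaShape x₁ x₂ x₃) (F : Set (X ↪o P))
    (hF : ∀ f ∈ F, ∀ g ∈ F, (∃ σ : X ≃o X, ∀ x, g x = f (σ x)) → f = g) :
    IsDetected k F := by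
  have : Finite (X ↪o P) := Finite.of_injective (fun f x => f x) DFunLike.coe_injective
  have key := unitriangular_criterion
    (fun j : F × LambdaKind x₃ => lambdaIndex x₁ x₂ x₃ j.1.1 j.2)
    (fun j => lambdaClass k x₁ x₂ x₃ j.1.1 j.2)
    (fun j => homTo (lowerThin k (lambdaIndex x₁ x₂ x₃ j.1.1 j.2)))
    (fun i j hij => lambdaClass_congr hX hF i.1.2 j.1.2 hij)
    (fun i j hij => by rw [hij])
    (fun i j hij => by
      rw [homTo_lambdaClass hX] at hij
      obtain ⟨h1, h2⟩ := of_not_not fun hn => hij (if_neg hn)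
      -- A point of the lower set of `j` lies below the top point of `j`, hence below that of `i`;
      -- outside the lower set of `i` it would lie in the support, contrary to `h2`.
      refine ⟨fun p hp => ?_, h1.1⟩
      by_contra hpi
      have hle : ∀ p ∈ (lambdaIndex x₁ x₂ x₃ j.1.1 j.2).1,
          p ≤ (lambdaIndex x₁ x₂ x₃ j.1.1 j.2).2 := lambdaIndex_le hX _ _
      exact h2 p hp (hle p hp) ⟨(hle p hp).trans h1.1, hpi⟩)
    (fun i => by
      rw [homTo_lambdaClass hX, if_pos]
      exact ⟨⟨le_rfl, lambdaIndex_notMem hX _ _⟩, fun p hp _ h => h.2 hp⟩)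
  constructor
  · rw [hX.closure_inducedSet]
    exact fun s hs h => key.1 s hs ((hX.dimhVanishes_iff F s).1 h)
  · rw [hX.closure_inducedSet]
    intro g
    obtain ⟨s, hs, h⟩ := key.2 g
    exact ⟨s, hs, (hX.dimhVanishes_iff F _).2 h⟩

end LambdaDetection

end PosetModules

/-! ### Assembly of the two cases. -/

theorem mainTheorem5 (k : Type u) [Field k] {X : Type v} [PartialOrder X] [Finite X]
    {P : Type w} [PartialOrder P] [Finite P] [IsConnected P]
    (hX : Nonempty (X ≃o VPoset) ∨ Nonempty (X ≃o LambdaPoset))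
    (rep : Emb X P → (X ↪o P)) (hrep : ∀ e, Emb.mk (rep e) = e)
    (E : Set (Emb X P)) (hE : (⋃ e ∈ E, Set.range (rep e)) = Set.univ) :
    IsInvariantBasis (dimh k rep E) (inducedClasses k rep E) ∧
    IsInvariantBasis (mult k rep E) (inducedClasses k rep E) ∧
    (Nonempty (X ≃o VPoset) → HasAcyclicGabrielQuiver (inducedClasses k rep E)) := by
  have hV : Nonempty (X ≃o VPoset) → HasAcyclicGabrielQuiver (inducedClasses k rep E) := fun h => by
    obtain ⟨x₁, x₂, x₃, h⟩ := exists_isVShape h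
    rw [inducedClasses_eq]
    exact h.hasAcyclicGabrielQuiver _
  rw [← and_assoc]
  refine ⟨?_, hV⟩
  rcases hX with h | h
  · obtain ⟨x₁, x₂, x₃, h⟩ := exists_isVShape h
    have := finite_indClass (k := k) fun _ hM => h.classification hM
    refine isInvariantBasis_dimh_mult (h.isDetected _) (fun U hU => ?_) rep E (h.isDetected _)
    obtain ⟨S, a, W, hS, ⟨φ⟩⟩ := h.exists_iso_hook hU
    rw [finrank_hom_congr_left k φ, finrank_hom_congr k _ φ, finrank_end_thin_hook hS]
  · obtain ⟨x₁, x₂, x₃, h⟩ := exists_isLambdaShape h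
    have := finite_indClass (k := k) fun _ hM => h.classification hM
    refine isInvariantBasis_dimh_mult (h.isDetected _ ?_) (fun U hU => ?_) rep E
      (h.isDetected _ ?_)
    · rintro f rfl g rfl -
      rfl
    · rcases h.classification hU with ⟨a, c, hac, ⟨φ⟩⟩ | ⟨⟨φ⟩⟩
      · rw [finrank_hom_congr_left k φ, finrank_hom_congr k _ φ,
          finrank_end_thin_hook (isHook_Icc hac)]
      · rw [finrank_hom_congr_left k φ, finrank_hom_congr k _ φ,
          finrank_end_thin_cohook (isCohook_univ h.le_top)]
    -- Chosen representatives that differ by an automorphism of `X` represent the same class, so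
    -- they coincide.
    · rintro _ ⟨e, -, rfl⟩ _ ⟨e', -, rfl⟩ hσ
      have : Emb.mk (rep e) = Emb.mk (rep e') := Quotient.sound hσ
      rw [hrep, hrep] at this
      rw [this]
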